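/- Let $\Omega$ be a bounded convex open set in $\mathbb R^2$, let $M>0$, and let $1\le r\le\infty$; smooth means of class $C^r$ (the result holds for each such $r$). Let $u:\overline\Omega\to\mathbb R$. A point $x\in\Omega$ is called a regular point of $u$ if $u$ is smooth in a neighbourhood of $x$. The function $u$ is called piecewise smooth if all points of $\Omega$ that are not regular points of $u$ lie on the union of finitely many compact smooth arcs in $\mathbb R^2$ (injective images of $[0,1]$ under $C^r$ curves with nonvanishing velocity), any two of which have at most finitely many common points; $u$ may be discontinuous across these arcs. A piecewise smooth $u$ satisfies the single impact condition (SIC) if for every regular point $x\in\Omega$ and every $t>0$ such that $x-t\nabla u(x)\in\overline\Omega$, $$\frac{u(x-t\nabla u(x))-u(x)}{t}\le\frac12\bigl(1-|\nabla u(x)|^2\bigr).$$ Let $\mathcal S_{\Omega,M}$ be the class of piecewise smooth functions $u:\overline\Omega\to\mathbb R$ that satisfy SIC and $0\le u(x)\le M$ for all $x\in\overline\Omega$, and for $u\in\mathcal S_{\Omega,M}$ let $$F(u)=\int_\Omega\frac{dx}{1+|\nabla u(x)|^2}.$$ Then $$\inf_{u\in\mathcal S_{\Omega,M}}F(u)=\phi(\Omega,M):=\int_\Omega\frac12\left(1-\frac{M}{\sqrt{M^2+d(x)^2}}\right)dx,\qquad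 d(x)=\operatorname{dist}(x,\partial\Omega).$$ -/

import Mathlib

open Set Filter MeasureTheory
open scoped Topology

namespace SingleImpact

/-- The Euclidean plane. -/
abbrev Plane : Type := EuclideanSpace ℝ (Fin 2)

/-- A compact arc of class `C^r`: the image of `[0, 1]` under an injective `C^r` curve with
nowhere vanishing velocity. -/
def IsSmoothArc (r : ℕ∞) (Γ : Set Plane) : Prop :=
  ∃ γ : ℝ → Plane, ContDiff ℝ r γ ∧ InjOn γ (Icc 0 1) ∧
    (∀ t ∈ Icc (0 : ℝ) 1, deriv γ t ≠ 0) ∧ γ '' Icc 0 1 = Γ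

/-- `x` is a regular point of `u`: the function `u` is of class `C^r` in a neighbourhood
of `x`. -/
def IsRegularPoint (r : ℕ∞) (u : Plane → ℝ) (x : Plane) : Prop :=
  ∀ᶠ y in 𝓝 x, ContDiffAt ℝ r u y

/-- `u` is piecewise smooth (of class `C^r`) on the open set `Ω`: finitely many `C^r` arcs, any
two of which meet in at most finitely many points, contain all points of `Ω` that are not regular
points of `u`. Discontinuities across the arcs are allowed. -/
def IsPiecewiseSmooth (r : ℕ∞) (Ω : Set Plane) (u : Plane → ℝ) : Prop :=
  ∃ A : Set (Set Plane), A.Finite ∧ (∀ Γ ∈ A, IsSmoothArc r Γ) ∧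
    A.Pairwise (fun Γ Γ' => (Γ ∩ Γ').Finite) ∧
    ∀ x ∈ Ω, ¬ IsRegularPoint r u x → x ∈ ⋃₀ A

/-- The single impact condition. -/
def SatisfiesSIC (r : ℕ∞) (Ω : Set Plane) (u : Plane → ℝ) : Prop :=
  ∀ x ∈ Ω, IsRegularPoint r u x → ∀ t : ℝ, 0 < t → x - t • gradient u x ∈ closure Ω →
    (u (x - t • gradient u x) - u x) / t ≤ 1 / 2 * (1 - ‖gradient u x‖ ^ 2)

/-- The admissible functions. They are represented by functions on the whole plane, of which only
the values on `closure Ω` are relevant. -/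
def admissible (r : ℕ∞) (Ω : Set Plane) (M : ℝ) : Set (Plane → ℝ) :=
  {u | IsPiecewiseSmooth r Ω u ∧ SatisfiesSIC r Ω u ∧ ∀ x ∈ closure Ω, 0 ≤ u x ∧ u x ≤ M}

/-- The resistance `F(u) = ∫_Ω dx / (1 + |∇u(x)|²)`. -/
noncomputable def resistance (Ω : Set Plane) (u : Plane → ℝ) : ℝ :=
  ∫ x in Ω, 1 / (1 + ‖gradient u x‖ ^ 2)

/-- `φ(Ω, M) = ∫_Ω ½ (1 - M / √(M² + d(x)²)) dx`, where `d(x)` is the distance from `x` to the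
boundary of `Ω`. -/
noncomputable def phi (Ω : Set Plane) (M : ℝ) : ℝ :=
  ∫ x in Ω, 1 / 2 * (1 - M / Real.sqrt (M ^ 2 + Metric.infDist x (frontier Ω) ^ 2))

end SingleImpact

/-!
At a regular point `x` with `g = ∇u(x)` the reflected particle moves in the direction `-g` and
descends at the rate `(‖g‖ - 1/‖g‖)/2`. It stays over `Ω` at least for the distance `d(x)`, and the
single impact condition keeps it above the graph, so it descends by at most `M`. Hence `‖g‖` is at
most the slope `criticalSlope M (d(x))`, which is equivalent to the bound of the integrand by the
integrand of `φ` (`localBound_le`); the arcs are null sets, so `φ ≤ F(u)` (`phi_le_resistance`).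

The bound would be attained if from almost every point the particle started at height `M`, moved
towards the nearest boundary point, and met nothing on its way down to height `0` there. This is
nearly achieved by a construction of Besicovitch type (`exists_sources`): for any prescribed
direction field, almost all of `Ω` is filled by finitely many disjoint polygonal pieces `O j`, such
that from each piece one can move out of `Ω`, in a direction close to the prescribed one, without
meeting another piece. On each small piece `u` is affine with values close to `M` and slope close
to critical; off the pieces `u = 0` (`exists_admissible_resistance_le`).

The core is planar. In coordinates `(t, x)`, with `t` measured in the prescribed direction, one
needs thin strips that are disjoint for `t ∈ [-h, 0]`, where they are the pieces, and whose
continuations for `t ∈ (0, R]` overlap so much that their union is small compared with the pieces,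
uniformly in `R` (`exists_strips`). They come from bundles of lines (`HasBundles`). A bundle through
one point at depth `s` has a small section near that depth. Cutting it into many bundles with
nearly the same lines, but passing through points at a smaller depth `s'`, keeps the sections at
depths `≥ s` almost unchanged and makes those at depths between `s'` and `s` small as well
(`HasBundles.step`). Starting at depth `R`, finitely many such steps lead to a depth that is small
compared with `h`. A comb of strips occupies a fixed proportion of a ball of its size
(`exists_comb`), so by the Vitali covering theorem disjoint combs of arbitrarily small sizes fill
almost all of `Ω`. The union of their continuations has small area and is removed from the pieces.
-/

namespace SingleImpact

/-! ### Bundles of lines with small sections -/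

/-- A finite family of bundles of lines `x = b + a t` in the `(t, x)`-plane. The `i`-th bundle
consists of the slopes `a ∈ [α i, α i + ℓ]` and passes through one point at depth `t = s`, so its
section at depth `t` is the interval between `β i + α i t` and `β i + α i t + (t - s) ℓ`.
For `t ∈ [-h, 0]` these sections are disjoint and lie in `(-W, 0]`, with total width `W` at
`t = -h`. For `t ∈ [s, R]` the union of the sections, even thickened by some `θ > 0`, has length
at most `δ`. -/
def HasBundles (h W R δ s : ℝ) : Prop :=
  ∃ (ι : Type) (_ : Fintype ι) (α β : ι → ℝ) (ℓ θ : ℝ), 0 < ℓ ∧ 0 < θ ∧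
    Fintype.card ι * ℓ = W / (s + h) ∧
    (∀ t ∈ Icc (-h) 0, ∀ i,
      Ioc (β i + α i * t - (s - t) * ℓ) (β i + α i * t) ⊆ Ioc (-W) 0) ∧
    (∀ t ∈ Icc (-h) 0, Pairwise fun i j =>
      Disjoint (Ioc (β i + α i * t - (s - t) * ℓ) (β i + α i * t))
        (Ioc (β j + α j * t - (s - t) * ℓ) (β j + α j * t))) ∧
    ∀ t ∈ Icc s R,
      volume (⋃ i, Icc (β i + α i * t - θ) (β i + α i * t + (t - s) * ℓ + θ)) ≤ ENNReal.ofReal δ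

/-- A single bundle focusing at depth `R`. -/
theorem hasBundles_self {h W R δ : ℝ} (hh : 0 < h) (hW : 0 < W) (hR : 0 < R) (hδ : 0 < δ) :
    HasBundles h W R δ R := by
  refine ⟨Unit, inferInstance, fun _ => 0, fun _ => 0, W / (R + h), δ / 2, by positivity,
    by positivity, by simp, ?_, ?_, ?_⟩
  · intro t ht _
    refine Ioc_subset_Ioc ?_ (by simp)
    have : (R - t) * (W / (R + h)) ≤ (R + h) * (W / (R + h)) := by
      have := ht.1
      gcongr
      linarith
    have h2 : (R + h) * (W / (R + h)) = W := by field_simp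
    simp only [zero_mul, add_zero, zero_sub]
    linarith
  · intro t _ i j hij
    exact absurd (Subsingleton.elim i j) hij
  · intro t ht
    obtain rfl : t = R := le_antisymm ht.2 ht.1
    simp only [iUnion_const, Real.volume_Icc]
    apply ENNReal.ofReal_le_ofReal
    linarith

/-- The intervals `(A - j x - y, A - j x]` are disjoint, since the parts `(A - (j + 1) x, A - j x]`
of a subdivision into pieces of length `x ≥ y` are. -/
theorem disjoint_Ioc_parts {A x y : ℝ} (hx : 0 < x) (hy : y ≤ x) {j k : ℕ} (hjk : j ≠ k) :
    Disjoint (Ioc (A - j * x - y) (A - j * x)) (Ioc (A - k * x - y) (A - k * x)) := by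
  wlog h : j < k generalizing j k
  · exact (this hjk.symm (lt_of_le_of_ne (not_lt.1 h) hjk.symm)).symm
  rw [Set.disjoint_left]
  rintro z ⟨h1, _⟩ ⟨_, h4⟩
  have h5 : (j : ℝ) + 1 ≤ k := by exact_mod_cast h
  nlinarith

theorem Ioc_part_subset {A x y : ℝ} (hx : 0 < x) (hy : y ≤ x) {n : ℕ} (j : Fin n) :
    Ioc (A - (j : ℕ) * x - y) (A - (j : ℕ) * x) ⊆ Ioc (A - n * x) A := by
  have h5 : ((j : ℕ) : ℝ) + 1 ≤ n := by exact_mod_cast j.2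
  have h6 : (0 : ℝ) ≤ (j : ℕ) := by positivity
  exact Ioc_subset_Ioc (by nlinarith) (by nlinarith)

/-- Moving the focal depth from `s` up to `s'`: each bundle is cut into `n` bundles with nearly
the same lines, refocused at depth `s'`. For large `n` the sections at depths `≥ s` hardly
change, and at depths in `[s', s]` they are short because the bundles nearly focus there. -/
theorem HasBundles.step {h W R δ s s' : ℝ} (hh : 0 < h) (hW : 0 < W) (hδ : 0 < δ)
    (hs' : 0 < s') (hss' : s' ≤ s) (hsR : s ≤ R) (hstep : (s - s') * (W / h) ≤ δ / 2)
    (H : HasBundles h W R δ s) : HasBundles h W R δ s' := by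
  obtain ⟨ι, _, α, β, ℓ, θ, hℓ, hθ, hcard, hsub, hdisj, hvol⟩ := H
  have hs : 0 < s := hs'.trans_le hss'
  obtain ⟨n, hn⟩ := exists_nat_gt (R * (ℓ * ((s + h) / (s' + h))) / (θ / 2))
  have hR : 0 < R := hs.trans_le hsR
  have hn0 : (0 : ℝ) < n := lt_of_le_of_lt (by positivity) hn
  set ℓ' : ℝ := ℓ / n * ((s + h) / (s' + h)) with hℓ'
  have hℓ'0 : 0 < ℓ' := by positivity
  have hRℓ' : R * ℓ' ≤ θ / 2 := by
    rw [div_lt_iff₀ (by positivity)] at hn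
    have : R * ℓ' = R * (ℓ * ((s + h) / (s' + h))) / n := by rw [hℓ']; field_simp
    rw [this, div_le_iff₀ hn0]
    linarith
  set C : ℝ := ((Fintype.card (ι × Fin n) : ℕ) : ℝ) with hC
  have hC0 : 0 ≤ C := by positivity
  have hCℓ' : C * ℓ' = W / (s' + h) := by
    have : C * ℓ' = (Fintype.card ι * ℓ) * ((s + h) / (s' + h)) := by
      simp only [hC, hℓ', Fintype.card_prod, Fintype.card_fin, Nat.cast_mul]
      field_simp
    rw [this, hcard]
    field_simp
  -- the refocused bundles are narrower than the pieces of the old ones for `t ∈ [-h, 0]`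
  have hwidth : ∀ t ∈ Icc (-h) 0, (s' - t) * ℓ' ≤ (s - t) * (ℓ / n) := by
    intro t ht
    have e : (s' - t) * ℓ' = (ℓ / n) * ((s' - t) * (s + h) / (s' + h)) := by
      rw [hℓ']; field_simp
    rw [e, mul_comm (s - t)]
    gcongr
    rw [div_le_iff₀ (by positivity)]
    nlinarith [ht.1, ht.2]
  have hform : ∀ t : ℝ, ∀ q : ι × Fin n,
      (β q.1 - s * ((q.2 : ℕ) * (ℓ / n))) + (α q.1 + (q.2 : ℕ) * (ℓ / n)) * t
        = β q.1 + α q.1 * t - (q.2 : ℕ) * ((s - t) * (ℓ / n)) := by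
    intro t q; ring
  have hn1 : ∀ t : ℝ, (n : ℝ) * ((s - t) * (ℓ / n)) = (s - t) * ℓ := by
    intro t; field_simp
  refine ⟨ι × Fin n, inferInstance, fun q => α q.1 + (q.2 : ℕ) * (ℓ / n),
    fun q => β q.1 - s * ((q.2 : ℕ) * (ℓ / n)), ℓ', min (θ / 2) (δ / (4 * (C + 1))), hℓ'0,
    by positivity, hCℓ', ?_, ?_, ?_⟩
  · intro t ht q
    have hst : 0 < (s - t) * (ℓ / n) := by have := ht.2; have : 0 < s - t := by linarith
                                           positivity
    rw [hform]
    refine (Ioc_part_subset hst (hwidth t ht) q.2).trans ?_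
    rw [hn1]
    exact hsub t ht q.1
  · intro t ht q q' hqq'
    have hst : 0 < (s - t) * (ℓ / n) := by have := ht.2; have : 0 < s - t := by linarith
                                           positivity
    rw [hform, hform]
    by_cases h1 : q.1 = q'.1
    · rw [h1]
      refine disjoint_Ioc_parts hst (hwidth t ht) fun h2 => hqq' ?_
      exact Prod.ext h1 (Fin.ext h2)
    · have := hdisj t ht h1
      refine this.mono ?_ ?_
      · have := Ioc_part_subset (A := β q.1 + α q.1 * t) hst (hwidth t ht) q.2
        rwa [hn1] at this
      · have := Ioc_part_subset (A := β q'.1 + α q'.1 * t) hst (hwidth t ht) q'.2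
        rwa [hn1] at this
  · intro t ht
    simp only [hform]
    rcases le_total s t with hst | hst
    · refine le_trans (measure_mono ?_) (hvol t ⟨hst, ht.2⟩)
      refine iUnion_subset fun q => ?_
      refine subset_trans (Icc_subset_Icc ?_ ?_) (subset_iUnion (fun i =>
        Icc (β i + α i * t - θ) (β i + α i * t + (t - s) * ℓ + θ)) q.1)
      · have : 0 ≤ ((q.2 : ℕ) : ℝ) * ((t - s) * (ℓ / n)) := by
          have : 0 ≤ t - s := by linarith
          positivity
        have := min_le_left (θ / 2) (δ / (4 * (C + 1)))
        nlinarith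
      · have h1 : ((q.2 : ℕ) : ℝ) * ((t - s) * (ℓ / n)) ≤ n * ((t - s) * (ℓ / n)) := by
          have : 0 ≤ t - s := by linarith
          have : ((q.2 : ℕ) : ℝ) ≤ n := by exact_mod_cast q.2.2.le
          gcongr
        have h2 : (n : ℝ) * ((t - s) * (ℓ / n)) = (t - s) * ℓ := by field_simp
        have h3 := min_le_left (θ / 2) (δ / (4 * (C + 1)))
        have h4 : (t - s') * ℓ' ≤ R * ℓ' := by
          have := ht.2
          gcongr
          linarith
        nlinarith
    · set θ' := min (θ / 2) (δ / (4 * (C + 1))) with hθ'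
      have h1 : ∀ q : ι × Fin n, volume (Icc
          (β q.1 + α q.1 * t - (q.2 : ℕ) * ((s - t) * (ℓ / n)) - θ')
          (β q.1 + α q.1 * t - (q.2 : ℕ) * ((s - t) * (ℓ / n)) + (t - s') * ℓ' + θ'))
          ≤ ENNReal.ofReal ((s - s') * ℓ' + 2 * θ') := by
        intro q
        rw [Real.volume_Icc]
        apply ENNReal.ofReal_le_ofReal
        have : (t - s') * ℓ' ≤ (s - s') * ℓ' := by gcongr
        linarith
      refine (measure_iUnion_le _).trans ?_
      rw [tsum_fintype]
      refine (Finset.sum_le_sum fun q _ => h1 q).trans ?_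
      rw [Finset.sum_const, nsmul_eq_mul, Finset.card_univ,
        ← ENNReal.ofReal_natCast, ← ENNReal.ofReal_mul (by positivity)]
      apply ENNReal.ofReal_le_ofReal
      rw [← hC]
      have h2 : C * ((s - s') * ℓ') ≤ δ / 2 := by
        have e : C * ((s - s') * ℓ') = (s - s') * (W / (s' + h)) := by rw [← hCℓ']; ring
        rw [e]
        refine le_trans ?_ hstep
        have : 0 ≤ s - s' := by linarith
        gcongr
        linarith
      have h3 : C * (2 * θ') ≤ δ / 2 := by
        have h4 := min_le_right (θ / 2) (δ / (4 * (C + 1)))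
        rw [← hθ', le_div_iff₀ (by positivity)] at h4
        have : 0 < θ' := by positivity
        nlinarith
      linarith

/-- The focal depth is moved from `R` to `s` in steps so short that `HasBundles.step` applies. -/
theorem hasBundles {h W R δ s : ℝ} (hh : 0 < h) (hW : 0 < W) (hδ : 0 < δ)
    (hs : 0 < s) (hsR : s ≤ R) : HasBundles h W R δ s := by
  obtain ⟨K, hK⟩ := exists_nat_gt ((R - s) * (W / h) / (δ / 2))
  have hRs : 0 ≤ R - s := by linarith
  have hK0 : (0 : ℝ) < K := lt_of_le_of_lt (by positivity) hK
  have key : ∀ k : ℕ, k ≤ K → HasBundles h W R δ (R - k * ((R - s) / K)) := by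
    intro k
    induction k with
    | zero => intro _; simpa using hasBundles_self hh hW (hs.trans_le hsR) hδ
    | succ k ih =>
      intro hk
      have hk' : ((k : ℝ) + 1) ≤ K := by exact_mod_cast hk
      have hq : 0 ≤ (R - s) / K := by positivity
      have hm : (K : ℝ) * ((R - s) / K) = R - s := by field_simp
      refine (ih (by omega)).step hh hW hδ ?_ ?_ ?_ ?_
      · push_cast
        nlinarith
      · push_cast
        nlinarith
      · have : 0 ≤ (k : ℝ) * ((R - s) / K) := by positivity
        linarith
      · rw [div_lt_iff₀ (by positivity)] at hK
        have e : (R - k * ((R - s) / K) - (R - (k + 1 : ℕ) * ((R - s) / K))) * (W / h)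
            = (R - s) * (W / h) / K := by push_cast; ring
        rw [e, div_le_iff₀ hK0]
        linarith
  have := key K le_rfl
  have hm : (K : ℝ) * ((R - s) / K) = R - s := by field_simp
  rwa [hm, sub_sub_cancel] at this

/-- The strips `{(t, x) | β i + α i t - w ≤ x ≤ β i + α i t}` are disjoint for `t ∈ [-h, 0]`,
where their areas sum up to `c h²` with `c = ε κ / (2 (2 + ε))` independent of `R`, whereas the
union of their parts with `t ∈ (0, R]` has area at most `ε c h²`. -/
theorem exists_strips {h κ ε : ℝ} (R : ℝ) (hh : 0 < h) (hκ : 0 < κ) (hε : 0 < ε) :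
    ∃ (ι : Type) (_ : Fintype ι) (α β : ι → ℝ) (w : ℝ), 0 < w ∧
      Fintype.card ι * w = ε * κ / (2 * (2 + ε)) * h ∧
      (∀ i, |α i| ≤ κ) ∧
      (∀ t ∈ Icc (-h) 0, ∀ i,
        Icc (β i + α i * t - w) (β i + α i * t) ⊆ Icc (-(κ * h)) 0) ∧
      (∀ t ∈ Icc (-h) 0, Pairwise fun i j =>
        Disjoint (Icc (β i + α i * t - w) (β i + α i * t))
          (Icc (β j + α j * t - w) (β j + α j * t))) ∧
      volume {q : ℝ × ℝ | q.1 ∈ Ioc 0 R ∧ ∃ i, q.2 ∈ Icc (β i + α i * q.1 - w) (β i + α i * q.1)}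
        ≤ ENNReal.ofReal (ε * (ε * κ / (2 * (2 + ε)) * h ^ 2)) := by
  set c : ℝ := ε * κ / (2 * (2 + ε)) with hc
  have hc0 : 0 < c := by positivity
  set s : ℝ := ε * h / 2 with hsdef
  have hs : 0 < s := by positivity
  set R' : ℝ := max R s with hR'
  have hR's : s ≤ R' := le_max_right _ _
  have hR'0 : 0 < R' := hs.trans_le hR's
  set δ : ℝ := ε * (c * h ^ 2) / (2 * R') with hδdef
  have hδ : 0 < δ := by positivity
  obtain ⟨ι, _, α, β, ℓ, θ, hℓ, hθ, hcard, hsub, hdisj, hvol⟩ :=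
    hasBundles (W := κ * h) hh (by positivity) hδ hs hR's
  obtain ⟨n, hn⟩ := exists_nat_gt (s * ℓ / (2 * θ))
  have hn0 : (0 : ℝ) < n := lt_of_le_of_lt (by positivity) hn
  set w : ℝ := s * ℓ / (2 * n) with hw
  have hw0 : 0 < w := by positivity
  have hwθ : w ≤ θ := by
    rw [div_lt_iff₀ (by positivity)] at hn
    rw [hw, div_le_iff₀ (by positivity)]
    linarith
  have hform : ∀ t : ℝ, ∀ q : ι × Fin n,
      (β q.1 - s * ((q.2 : ℕ) * (ℓ / n))) + (α q.1 + (q.2 : ℕ) * (ℓ / n)) * t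
        = β q.1 + α q.1 * t - (q.2 : ℕ) * ((s - t) * (ℓ / n)) := by
    intro t q; ring
  have hn1 : ∀ t : ℝ, (n : ℝ) * ((s - t) * (ℓ / n)) = (s - t) * ℓ := by
    intro t; field_simp
  -- the closed strips of width `w` sit in half-open intervals of width `2 w ≤ (s - t) ℓ / n`
  have hwidth : ∀ t ∈ Icc (-h) 0, 2 * w ≤ (s - t) * (ℓ / n) := by
    intro t ht
    have e : 2 * w = s * (ℓ / n) := by rw [hw]; field_simp
    rw [e]
    have := ht.2
    gcongr
    linarith
  have hpos : ∀ t ∈ Icc (-h) 0, 0 < (s - t) * (ℓ / n) := fun t ht =>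
    lt_of_lt_of_le (by positivity) (hwidth t ht)
  have hIcc : ∀ A : ℝ, Icc (A - w) A ⊆ Ioc (A - 2 * w) A := fun A x hx =>
    ⟨by linarith [hx.1], hx.2⟩
  have hcw : (Fintype.card (ι × Fin n) : ℝ) * w = c * h := by
    have e : (Fintype.card (ι × Fin n) : ℝ) * w = (Fintype.card ι * ℓ) * (s / 2) := by
      simp only [hw, Fintype.card_prod, Fintype.card_fin, Nat.cast_mul]
      field_simp
    rw [e, hcard, hsdef, hc]
    field_simp
    ring
  have hbox : ∀ t ∈ Icc (-h) 0, ∀ q : ι × Fin n,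
      Icc (β q.1 + α q.1 * t - (q.2 : ℕ) * ((s - t) * (ℓ / n)) - w)
        (β q.1 + α q.1 * t - (q.2 : ℕ) * ((s - t) * (ℓ / n))) ⊆ Ioc (-(κ * h)) 0 := by
    intro t ht q
    refine (hIcc _).trans ((Ioc_part_subset (hpos t ht) (hwidth t ht) q.2).trans ?_)
    rw [hn1]
    exact hsub t ht q.1
  refine ⟨ι × Fin n, inferInstance, fun q => α q.1 + (q.2 : ℕ) * (ℓ / n),
    fun q => β q.1 - s * ((q.2 : ℕ) * (ℓ / n)), w, hw0, hcw, ?_, ?_, ?_, ?_⟩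
  · -- both ends of a strip lie in an interval of length `κ h`, and their levels differ by `h`
    intro q
    have h0 := hbox 0 ⟨by linarith, le_rfl⟩ q (right_mem_Icc.2 (by linarith))
    have h1 := hbox (-h) ⟨le_rfl, by linarith⟩ q (right_mem_Icc.2 (by linarith))
    rw [← hform] at h0 h1
    have h2 : |(α q.1 + (q.2 : ℕ) * (ℓ / n)) * h| ≤ κ * h := by
      rw [abs_le]
      constructor <;> linarith [h0.1, h0.2, h1.1, h1.2]
    rw [abs_mul, abs_of_pos hh] at h2
    exact le_of_mul_le_mul_right h2 hh
  · intro t ht q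
    rw [hform]
    exact (hbox t ht q).trans Ioc_subset_Icc_self
  · intro t ht q q' hqq'
    rw [hform, hform]
    by_cases h1 : q.1 = q'.1
    · rw [h1]
      refine (disjoint_Ioc_parts (hpos t ht) (hwidth t ht) fun h2 => hqq' ?_).mono
        (hIcc _) (hIcc _)
      exact Prod.ext h1 (Fin.ext h2)
    · refine (hdisj t ht h1).mono ((hIcc _).trans ?_) ((hIcc _).trans ?_)
      · have := Ioc_part_subset (A := β q.1 + α q.1 * t) (hpos t ht) (hwidth t ht) q.2
        rwa [hn1] at this
      · have := Ioc_part_subset (A := β q'.1 + α q'.1 * t) (hpos t ht) (hwidth t ht) q'.2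
        rwa [hn1] at this
  · simp only [hform]
    set E : Set (ℝ × ℝ) := {q : ℝ × ℝ | q.1 ∈ Ioc 0 R ∧ ∃ i : ι × Fin n,
      q.2 ∈ Icc (β i.1 + α i.1 * q.1 - (i.2 : ℕ) * ((s - q.1) * (ℓ / n)) - w)
        (β i.1 + α i.1 * q.1 - (i.2 : ℕ) * ((s - q.1) * (ℓ / n)))} with hE
    have hEm : MeasurableSet E := by
      have hEeq : E = (Prod.fst ⁻¹' Ioc 0 R) ∩ ⋃ i : ι × Fin n,
          ({q : ℝ × ℝ | β i.1 + α i.1 * q.1 - (i.2 : ℕ) * ((s - q.1) * (ℓ / n)) - w ≤ q.2} ∩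
          {q : ℝ × ℝ | q.2 ≤ β i.1 + α i.1 * q.1 - (i.2 : ℕ) * ((s - q.1) * (ℓ / n))}) := by
        ext q
        simp only [hE, mem_ofPred_eq, mem_inter_iff, mem_iUnion, mem_preimage, mem_Icc]
      rw [hEeq]
      refine (measurable_fst measurableSet_Ioc).inter (MeasurableSet.iUnion fun i => ?_)
      exact (isClosed_le (by fun_prop) (by fun_prop)).measurableSet.inter
        (isClosed_le (by fun_prop) (by fun_prop)).measurableSet
    have hsec : ∀ t : ℝ, volume (Prod.mk t ⁻¹' E) ≤
        (Ioc 0 s).indicator (fun _ => ENNReal.ofReal (c * h)) t +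
          (Ioc s R').indicator (fun _ => ENNReal.ofReal δ) t := by
      intro t
      by_cases ht : t ∈ Ioc 0 R
      · rcases le_or_gt t s with hts | hts
        · refine le_add_of_le_left ?_
          rw [indicator_of_mem (show t ∈ Ioc 0 s from ⟨ht.1, hts⟩)]
          have : Prod.mk t ⁻¹' E ⊆ ⋃ i : ι × Fin n,
              Icc (β i.1 + α i.1 * t - (i.2 : ℕ) * ((s - t) * (ℓ / n)) - w)
                (β i.1 + α i.1 * t - (i.2 : ℕ) * ((s - t) * (ℓ / n))) := by
            rintro x ⟨_, i, hi⟩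
            exact mem_iUnion.2 ⟨i, hi⟩
          refine (measure_mono this).trans ((measure_iUnion_le _).trans ?_)
          rw [tsum_fintype]
          simp only [Real.volume_Icc, sub_sub_cancel]
          rw [Finset.sum_const, nsmul_eq_mul, Finset.card_univ, ← ENNReal.ofReal_natCast,
            ← ENNReal.ofReal_mul (by positivity), hcw]
        · have htR' : t ≤ R' := ht.2.trans (le_max_left _ _)
          refine le_add_of_le_right ?_
          rw [indicator_of_mem (show t ∈ Ioc s R' from ⟨hts, htR'⟩)]
          refine (measure_mono ?_).trans (hvol t ⟨hts.le, htR'⟩)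
          rintro x ⟨_, i, hi1, hi2⟩
          refine mem_iUnion.2 ⟨i.1, ?_, ?_⟩
          · have : 0 ≤ ((i.2 : ℕ) : ℝ) * ((t - s) * (ℓ / n)) := by
              have : 0 ≤ t - s := by linarith
              positivity
            simp only at hi1
            nlinarith
          · have h1 : ((i.2 : ℕ) : ℝ) * ((t - s) * (ℓ / n)) ≤ n * ((t - s) * (ℓ / n)) := by
              have : 0 ≤ t - s := by linarith
              have : ((i.2 : ℕ) : ℝ) ≤ n := by exact_mod_cast i.2.2.le
              gcongr
            have h2 : (n : ℝ) * ((t - s) * (ℓ / n)) = (t - s) * ℓ := by field_simp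
            simp only at hi2
            nlinarith
      · have : Prod.mk t ⁻¹' E = ∅ := by
          ext x
          simp only [mem_preimage, mem_empty_iff_false, iff_false]
          exact fun hx => ht hx.1
        rw [this]
        simp
    rw [Measure.volume_eq_prod, Measure.prod_apply hEm]
    refine (lintegral_mono hsec).trans ?_
    rw [lintegral_add_left (measurable_const.indicator measurableSet_Ioc),
      lintegral_indicator_const measurableSet_Ioc, lintegral_indicator_const measurableSet_Ioc,
      Real.volume_Ioc, Real.volume_Ioc, ← ENNReal.ofReal_mul (by positivity),
      ← ENNReal.ofReal_mul hδ.le, ← ENNReal.ofReal_add (by positivity)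
        (mul_nonneg hδ.le (by linarith))]
    apply ENNReal.ofReal_le_ofReal
    have h1 : δ * (R' - s) ≤ ε * (c * h ^ 2) / 2 := by
      have e : δ * R' = ε * (c * h ^ 2) / 2 := by rw [hδdef]; field_simp
      nlinarith
    have h2 : c * h * (s - 0) = ε * (c * h ^ 2) / 2 := by rw [hsdef]; ring
    linarith

/-! ### Lines, arcs and polygonal boundaries -/

theorem volume_image_eq_zero {γ : ℝ → Plane} (hγ : ContDiff ℝ 1 γ) (s : Set ℝ) :
    volume (γ '' s) = 0 := by
  -- `γ` is extended to the plane as a function of the first coordinate, with singular derivative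
  set g : Plane → Plane := fun y => γ (y 0) with hg
  have hproj : ∀ y : Plane, HasFDerivAt (fun y : Plane => y 0)
      (EuclideanSpace.proj (𝕜 := ℝ) (0 : Fin 2) : Plane →L[ℝ] ℝ) y := fun y =>
    (EuclideanSpace.proj (𝕜 := ℝ) (0 : Fin 2) : Plane →L[ℝ] ℝ).hasFDerivAt
  have hd : ∀ y : Plane, HasFDerivAt g ((fderiv ℝ γ (y 0)).comp
      (EuclideanSpace.proj (𝕜 := ℝ) (0 : Fin 2) : Plane →L[ℝ] ℝ)) y := fun y =>
    HasFDerivAt.comp y ((hγ.differentiable (by norm_num)) (y 0)).hasFDerivAt (hproj y)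
  have hzero := addHaar_image_eq_zero_of_det_fderivWithin_eq_zero (volume : Measure Plane)
    (f := g) (s := univ) (fun y _ => (hd y).hasFDerivWithinAt) (by
      intro y _
      by_contra hne
      have hinj := (LinearMap.equivOfDetNeZero _ hne).injective
      have h0 : (EuclideanSpace.single (1 : Fin 2) (1 : ℝ) : Plane) = 0 := by
        apply hinj
        rw [map_zero]
        change fderiv ℝ γ (y 0) ((EuclideanSpace.single (1 : Fin 2) (1 : ℝ) : Plane) 0) = 0
        simp
      have := congrArg (fun z : Plane => z 1) h0
      simp at this)
  refine measure_mono_null ?_ hzero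
  rintro _ ⟨t, _, rfl⟩
  exact ⟨EuclideanSpace.single 0 t, mem_univ _, by simp [hg]⟩

/-- A straight line in the plane. -/
def IsLine (l : Set Plane) : Prop :=
  ∃ n : Plane, n ≠ 0 ∧ ∃ c : ℝ, l = {y | inner ℝ n y = c}

theorem IsLine.exists_param {l : Set Plane} (hl : IsLine l) :
    ∃ q v : Plane, v ≠ 0 ∧ l = range fun τ : ℝ => q + τ • v := by
  obtain ⟨n, hn, c, rfl⟩ := hl
  have hN : 0 < n 0 ^ 2 + n 1 ^ 2 := by
    by_contra hcon
    apply hn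
    have h0 : n 0 = 0 := by nlinarith [sq_nonneg (n 0), sq_nonneg (n 1)]
    have h1 : n 1 = 0 := by nlinarith [sq_nonneg (n 0), sq_nonneg (n 1)]
    ext i
    fin_cases i <;> simpa
  have hN' := hN.ne'
  refine ⟨(c / (n 0 ^ 2 + n 1 ^ 2)) • n, !₂[-n 1, n 0], ?_, ?_⟩
  · intro h
    apply hN'
    have h0 := congrArg (fun z : Plane => z 0) h
    have h1 := congrArg (fun z : Plane => z 1) h
    simp at h0 h1
    simp [h0, h1]
  · ext y
    simp only [mem_ofPred_eq, mem_range, PiLp.inner_apply, Fin.sum_univ_two]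
    simp only [RCLike.inner_apply, conj_trivial]
    constructor
    · intro h
      refine ⟨(n 0 * y 1 - n 1 * y 0) / (n 0 ^ 2 + n 1 ^ 2), ?_⟩
      ext i
      fin_cases i
      · simp
        field_simp
        rw [← h]
        ring
      · simp
        field_simp
        rw [← h]
        ring
    · rintro ⟨τ, rfl⟩
      simp
      field_simp
      ring

theorem IsLine.volume_eq_zero {l : Set Plane} (hl : IsLine l) : volume l = 0 := by
  obtain ⟨q, v, _, rfl⟩ := hl.exists_param
  rw [← image_univ]
  exact volume_image_eq_zero (by fun_prop) univ

theorem IsLine.finite_inter {l l' : Set Plane} (hl : IsLine l) (hl' : IsLine l') (h : l ≠ l') :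
    (l ∩ l').Finite := by
  obtain ⟨q, v, _, rfl⟩ := hl.exists_param
  obtain ⟨q', v', _, rfl⟩ := hl'.exists_param
  refine Set.Subsingleton.finite fun x hx y hy => ?_
  by_contra hxy
  have key : ∀ q v : Plane, x ∈ range (fun τ : ℝ => q + τ • v) →
      y ∈ range (fun τ : ℝ => q + τ • v) →
      range (fun τ : ℝ => q + τ • v) = range (fun τ : ℝ => x + τ • (y - x)) := by
    rintro q v ⟨a, rfl⟩ ⟨b, rfl⟩
    have hab : b - a ≠ 0 := fun h0 => hxy (by rw [sub_eq_zero.1 h0])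
    ext z
    constructor
    · rintro ⟨τ, rfl⟩
      refine ⟨(τ - a) / (b - a), ?_⟩
      have e : q + b • v - (q + a • v) = (b - a) • v := by module
      simp only [e, smul_smul, div_mul_cancel₀ _ hab]
      module
    · rintro ⟨τ, rfl⟩
      refine ⟨a + τ * (b - a), ?_⟩
      module
  exact h ((key q v hx.1 hy.1).trans (key q' v' hx.2 hy.2).symm)

/-- The part of a line in a bounded set lies on a straight segment contained in the line. -/
theorem IsLine.exists_arc {l : Set Plane} (hl : IsLine l) (r : ℕ∞) {Ω : Set Plane}
    (hΩ : Bornology.IsBounded Ω) : ∃ Γ, IsSmoothArc r Γ ∧ Γ ⊆ l ∧ l ∩ Ω ⊆ Γ := by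
  obtain ⟨q, v, hv, rfl⟩ := hl.exists_param
  obtain ⟨K, hK⟩ := hΩ.subset_closedBall q
  have hv0 : 0 < ‖v‖ := norm_pos_iff.2 hv
  set L : ℝ := (|K| + 1) / ‖v‖ with hL
  have hL0 : 0 < L := by positivity
  have hder : ∀ t, HasDerivAt (fun t : ℝ => q + ((2 * t - 1) * L) • v) ((2 * L) • v) t := by
    intro t
    have h1 : HasDerivAt (fun t : ℝ => (2 * t - 1) * L) (2 * L) t := by
      simpa using (((hasDerivAt_id t).const_mul 2).sub_const 1).mul_const L
    exact (h1.smul_const v).const_add q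
  refine ⟨_, ⟨fun t => q + ((2 * t - 1) * L) • v, by fun_prop, ?_, ?_, rfl⟩, ?_, ?_⟩
  · intro a _ b _ hab
    have h1 : ((2 * a - 1) * L - (2 * b - 1) * L) • v = 0 := by
      rw [sub_smul, sub_eq_zero]
      exact add_left_cancel hab
    have h2 := (smul_eq_zero.1 h1).resolve_right hv
    have h3 : (a - b) * (2 * L) = 0 := by linarith
    have := (mul_eq_zero.1 h3).resolve_right (by positivity)
    linarith
  · intro t _
    rw [(hder t).deriv]
    exact smul_ne_zero (by positivity) hv
  · rintro _ ⟨t, _, rfl⟩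
    exact ⟨_, rfl⟩
  · rintro _ ⟨⟨τ, rfl⟩, hτ⟩
    have h1 := hK hτ
    rw [mem_closedBall_iff_norm, add_sub_cancel_left, norm_smul, Real.norm_eq_abs] at h1
    have h2 : |τ| ≤ L := by
      rw [hL, le_div_iff₀ hv0]
      linarith [le_abs_self K]
    rw [abs_le] at h2
    refine ⟨(τ / L + 1) / 2, ⟨?_, ?_⟩, ?_⟩
    · have : -1 ≤ τ / L := by rw [le_div_iff₀ hL0]; linarith
      linarith
    · have : τ / L ≤ 1 := by rw [div_le_iff₀ hL0]; linarith
      linarith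
    · have : (2 * ((τ / L + 1) / 2) - 1) * L = τ := by field_simp; ring
      simp only [this]

/-- The boundary of `S` is covered by finitely many lines. -/
def HasLinearFrontier (S : Set Plane) : Prop :=
  ∃ A : Set (Set Plane), A.Finite ∧ (∀ l ∈ A, IsLine l) ∧ frontier S ⊆ ⋃₀ A

theorem HasLinearFrontier.compl {S : Set Plane} (h : HasLinearFrontier S) :
    HasLinearFrontier Sᶜ := by
  rwa [HasLinearFrontier, frontier_compl]

theorem HasLinearFrontier.interior {S : Set Plane} (h : HasLinearFrontier S) :
    HasLinearFrontier (interior S) := by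
  obtain ⟨A, hA, hl, hS⟩ := h
  exact ⟨A, hA, hl, frontier_interior_subset.trans hS⟩

theorem HasLinearFrontier.inter {S T : Set Plane} (h : HasLinearFrontier S)
    (h' : HasLinearFrontier T) : HasLinearFrontier (S ∩ T) := by
  obtain ⟨A, hA, hl, hS⟩ := h
  obtain ⟨B, hB, hl', hT⟩ := h'
  refine ⟨A ∪ B, hA.union hB, fun l hlm => hlm.elim (hl l) (hl' l), ?_⟩
  rw [sUnion_union]
  exact (frontier_inter_subset S T).trans
    (union_subset_union (inter_subset_left.trans hS) (inter_subset_right.trans hT))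

theorem HasLinearFrontier.iInter {ι : Type*} [Finite ι] {S : ι → Set Plane}
    (h : ∀ i, HasLinearFrontier (S i)) : HasLinearFrontier (⋂ i, S i) := by
  have := Fintype.ofFinite ι
  have key : ∀ F : Finset ι, HasLinearFrontier (⋂ i ∈ F, S i) := by
    classical
    intro F
    induction F using Finset.induction_on with
    | empty => exact ⟨∅, finite_empty, by simp, by simp⟩
    | insert a F ha ih =>
      rw [Finset.set_biInter_insert]
      exact (h a).inter ih
  simpa using key Finset.univ

theorem HasLinearFrontier.volume_frontier {S : Set Plane} (h : HasLinearFrontier S) :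
    volume (frontier S) = 0 := by
  obtain ⟨A, hA, hl, hS⟩ := h
  refine measure_mono_null hS ?_
  rw [measure_sUnion_null_iff hA.countable]
  exact fun l hlA => (hl l hlA).volume_eq_zero

/-! ### Combs of strips in the plane -/

/-- The closed half-plane with inner normal `n` at signed offset `c` from `p`. -/
def halfPlane (p n : Plane) (c : ℝ) : Set Plane := {y | c ≤ inner ℝ n (y - p)}

theorem mem_halfPlane {p n : Plane} {c : ℝ} {y : Plane} :
    y ∈ halfPlane p n c ↔ c ≤ inner ℝ n (y - p) := Iff.rfl

theorem isClosed_halfPlane (p n : Plane) (c : ℝ) : IsClosed (halfPlane p n c) :=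
  isClosed_le continuous_const (by fun_prop)

theorem hasLinearFrontier_halfPlane (p : Plane) {n : Plane} (hn : n ≠ 0) (c : ℝ) :
    HasLinearFrontier (halfPlane p n c) := by
  refine ⟨{{y | inner ℝ n y = c + inner ℝ n p}}, finite_singleton _, ?_, ?_⟩
  · rintro l rfl
    exact ⟨n, hn, _, rfl⟩
  · rw [sUnion_singleton]
    refine (frontier_le_subset_eq continuous_const (by fun_prop)).trans ?_
    intro y hy
    rw [mem_ofPred_eq, inner_sub_right] at hy
    rw [mem_ofPred_eq]
    linarith

theorem exists_orthonormalBasis_zero_eq {e : Plane} (he : ‖e‖ = 1) :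
    ∃ b : OrthonormalBasis (Fin 2) ℝ Plane, b 0 = e := by
  have ho : Orthonormal ℝ (({0} : Set (Fin 2)).domRestrict fun _ => e) := by
    constructor
    · intro i; exact he
    · intro i j hij
      exact absurd (Subsingleton.elim i j) hij
  obtain ⟨b, hb⟩ := ho.exists_orthonormalBasis_extension_of_card_eq (by simp)
  exact ⟨b, hb 0 rfl⟩

/-- Cartesian coordinates in the plane with origin `p` and axes `b 0`, `b 1`. -/
noncomputable def coords (b : OrthonormalBasis (Fin 2) ℝ Plane) (p y : Plane) : ℝ × ℝ :=
  (inner ℝ (b 0) (y - p), inner ℝ (b 1) (y - p))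

theorem measurePreserving_coords (b : OrthonormalBasis (Fin 2) ℝ Plane) (p : Plane) :
    MeasurePreserving (coords b p) := by
  have h1 : MeasurePreserving (fun y : Plane => y - p) := measurePreserving_sub_right volume p
  have h2 := b.measurePreserving_repr
  have h3 := PiLp.volume_preserving_ofLp (Fin 2)
  have h4 := volume_preserving_finTwoArrow ℝ
  have := h4.comp (h3.comp (h2.comp h1))
  have e : coords b p = MeasurableEquiv.finTwoArrow ∘ WithLp.ofLp ∘ b.repr ∘ fun y => y - p := by
    funext y
    simp [coords, b.repr_apply_apply, inner_sub_right]
  rw [e]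
  exact this

theorem norm_sq_eq_coords (b : OrthonormalBasis (Fin 2) ℝ Plane) (p y : Plane) :
    ‖y - p‖ ^ 2 = (coords b p y).1 ^ 2 + (coords b p y).2 ^ 2 := by
  have := b.sum_sq_norm_inner_right (y - p)
  rw [← this, Fin.sum_univ_two]
  simp [coords]

/-- The area of a strip of width `w` between two levels at distance `h`. -/
theorem volume_strip {h w : ℝ} (hw : 0 ≤ w) (f : ℝ → ℝ) (hf : Continuous f) :
    volume {q : ℝ × ℝ | q.1 ∈ Icc (-h) 0 ∧ q.2 ∈ Icc (f q.1 - w) (f q.1)} =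
      ENNReal.ofReal (w * h) := by
  have hcl : IsClosed {q : ℝ × ℝ | q.1 ∈ Icc (-h) 0 ∧ q.2 ∈ Icc (f q.1 - w) (f q.1)} :=
    (isClosed_Icc.preimage continuous_fst).inter
      ((isClosed_le (f := fun q : ℝ × ℝ => f q.1 - w) (g := Prod.snd) (by fun_prop)
        (by fun_prop)).inter (isClosed_le (f := Prod.snd) (g := fun q : ℝ × ℝ => f q.1)
          (by fun_prop) (by fun_prop)))
  rw [Measure.volume_eq_prod, Measure.prod_apply hcl.measurableSet]
  have hsec : ∀ t : ℝ, volume (Prod.mk t ⁻¹'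
      {q : ℝ × ℝ | q.1 ∈ Icc (-h) 0 ∧ q.2 ∈ Icc (f q.1 - w) (f q.1)}) =
      (Icc (-h) 0).indicator (fun _ => ENNReal.ofReal w) t := by
    intro t
    by_cases ht : t ∈ Icc (-h) 0
    · have : Prod.mk t ⁻¹' {q : ℝ × ℝ | q.1 ∈ Icc (-h) 0 ∧ q.2 ∈ Icc (f q.1 - w) (f q.1)} =
          Icc (f t - w) (f t) := by
        ext x
        exact ⟨fun hx => hx.2, fun hx => ⟨ht, hx⟩⟩
      rw [this, Real.volume_Icc, indicator_of_mem ht, sub_sub_cancel]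
    · have : Prod.mk t ⁻¹' {q : ℝ × ℝ | q.1 ∈ Icc (-h) 0 ∧ q.2 ∈ Icc (f q.1 - w) (f q.1)} =
          ∅ := by
        ext x
        exact ⟨fun hx => ht hx.1, fun hx => hx.elim⟩
      rw [this, measure_empty, indicator_of_notMem ht]
  simp only [hsec]
  rw [lintegral_indicator_const measurableSet_Icc, Real.volume_Icc, ← ENNReal.ofReal_mul hw]
  simp

/-- A comb at `p` in the direction of the unit vector `e`: finitely many disjoint thin closed
parallelograms `S i` near `p`, each swept out within a closed half-strip `T i` in a direction
`v i` close to `e`. The parallelograms have total area `c h²` with `c = ε κ / (2 (2 + ε))`, whereas the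
remaining parts of the half-strips, up to a fixed distance `R`, have area at most `ε c h²`. -/
theorem exists_comb {κ ε h : ℝ} (R : ℝ) (hκ : 0 < κ) (hκ1 : κ ≤ 1) (hε : 0 < ε) (hh : 0 < h)
    (p : Plane) {e : Plane} (he : ‖e‖ = 1) :
    ∃ (ι : Type) (_ : Finite ι) (v : ι → Plane) (S T : ι → Set Plane),
      (∀ i, inner ℝ e (v i) = 1 ∧ ‖v i‖ ^ 2 ≤ 1 + κ ^ 2) ∧
      (∀ i, IsClosed (S i) ∧ HasLinearFrontier (S i)) ∧
      (∀ i, IsClosed (T i) ∧ HasLinearFrontier (T i)) ∧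
      (∀ i, S i ⊆ Metric.closedBall p (2 * h)) ∧
      (Pairwise fun i j => Disjoint (S i) (S j)) ∧
      (∀ i, ∀ y ∈ S i, ∀ τ : ℝ, 0 ≤ τ → y + τ • v i ∈ T i) ∧
      volume (⋃ i, S i) = ENNReal.ofReal (ε * κ / (2 * (2 + ε)) * h ^ 2) ∧
      volume ({y | inner ℝ e (y - p) ≤ R} ∩ ⋃ i, T i \ S i) ≤
        ENNReal.ofReal (ε * (ε * κ / (2 * (2 + ε)) * h ^ 2)) := by
  obtain ⟨b, rfl⟩ := exists_orthonormalBasis_zero_eq he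
  obtain ⟨ι, _, α, β, w, hw, hcard, hα, hbox, hdisj, hvol⟩ := exists_strips R hh hκ hε
  have h00 : inner ℝ (b 0) (b 0) = (1 : ℝ) := by simp
  have h11 : inner ℝ (b 1) (b 1) = (1 : ℝ) := by simp
  have h01 : inner ℝ (b 0) (b 1) = (0 : ℝ) := b.orthonormal.2 (by decide)
  have h10 : inner ℝ (b 1) (b 0) = (0 : ℝ) := b.orthonormal.2 (by decide)
  set T : ι → Set Plane := fun i => halfPlane p (b 0) (-h) ∩
    (halfPlane p (α i • b 0 - b 1) (-β i) ∩ halfPlane p (b 1 - α i • b 0) (β i - w)) with hT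
  set S : ι → Set Plane := fun i => T i ∩ halfPlane p (-b 0) 0 with hS
  have memT : ∀ i y, y ∈ T i ↔ -h ≤ (coords b p y).1 ∧
      (coords b p y).2 ∈ Icc (β i + α i * (coords b p y).1 - w)
        (β i + α i * (coords b p y).1) := by
    intro i y
    simp only [hT, mem_inter_iff, mem_halfPlane, inner_sub_left, real_inner_smul_left, coords,
      mem_Icc]
    constructor
    · rintro ⟨h1, h2, h3⟩
      exact ⟨h1, by linarith, by linarith⟩
    · rintro ⟨h1, h2, h3⟩
      exact ⟨h1, by linarith, by linarith⟩
  have memS : ∀ i y, y ∈ S i ↔ (coords b p y).1 ∈ Icc (-h) 0 ∧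
      (coords b p y).2 ∈ Icc (β i + α i * (coords b p y).1 - w)
        (β i + α i * (coords b p y).1) := by
    intro i y
    have h0 : y ∈ halfPlane p (-b 0) 0 ↔ (coords b p y).1 ≤ 0 := by
      simp only [mem_halfPlane, inner_neg_left, coords]
      constructor <;> intro _ <;> linarith
    rw [hS]
    simp only [mem_inter_iff, memT, h0, mem_Icc]
    tauto
  have hb0 : b 0 ≠ 0 := b.orthonormal.ne_zero 0
  have hn1 : ∀ i, α i • b 0 - b 1 ≠ 0 := by
    intro i h0
    have := congrArg (fun z => inner ℝ (b 1) z) h0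
    simp only [inner_sub_right, real_inner_smul_right, h10, h11, inner_zero_right] at this
    norm_num at this
  have hn2 : ∀ i, b 1 - α i • b 0 ≠ 0 := by
    intro i h0
    exact hn1 i (by rw [← neg_sub, h0, neg_zero])
  have hTc : ∀ i, IsClosed (T i) := fun i => (isClosed_halfPlane _ _ _).inter
    ((isClosed_halfPlane _ _ _).inter (isClosed_halfPlane _ _ _))
  have hTl : ∀ i, HasLinearFrontier (T i) := fun i => (hasLinearFrontier_halfPlane _ hb0 _).inter
    ((hasLinearFrontier_halfPlane _ (hn1 i) _).inter (hasLinearFrontier_halfPlane _ (hn2 i) _))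
  have hSc : ∀ i, IsClosed (S i) := fun i => (hTc i).inter (isClosed_halfPlane _ _ _)
  have hSdisj : Pairwise fun i j => Disjoint (S i) (S j) := by
    intro i j hij
    rw [Set.disjoint_left]
    intro y hi hj
    rw [memS] at hi hj
    exact Set.disjoint_left.1 (hdisj _ hi.1 hij) hi.2 hj.2
  have hψ := measurePreserving_coords b p
  refine ⟨ι, inferInstance, fun i => b 0 + α i • b 1, S, T, ?_, ?_, fun i => ⟨hTc i, hTl i⟩,
    ?_, hSdisj, ?_, ?_, ?_⟩
  · intro i
    constructor
    · rw [inner_add_right, real_inner_smul_right, h00, h01]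
      ring
    · rw [← real_inner_self_eq_norm_sq, inner_add_left, inner_add_right, inner_add_right,
        real_inner_smul_left, real_inner_smul_left, real_inner_smul_right, real_inner_smul_right,
        h00, h01, h10, h11]
      have := sq_le_sq' (abs_le.1 (hα i)).1 (abs_le.1 (hα i)).2
      nlinarith
  · intro i
    exact ⟨hSc i, (hTl i).inter (hasLinearFrontier_halfPlane _ (neg_ne_zero.2 hb0) _)⟩
  · intro i y hy
    rw [memS] at hy
    have h1 := hbox _ hy.1 i hy.2
    rw [mem_closedBall_iff_norm]
    refine abs_le_of_sq_le_sq' ?_ (by positivity) |>.2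
    rw [norm_sq_eq_coords b]
    have h2 : (coords b p y).1 ^ 2 ≤ h ^ 2 := by nlinarith [hy.1.1, hy.1.2]
    have h3 : (coords b p y).2 ^ 2 ≤ h ^ 2 := by
      have : -h ≤ (coords b p y).2 := by nlinarith [h1.1]
      nlinarith [h1.2]
    nlinarith
  · intro i y hy τ hτ
    rw [memS] at hy
    rw [memT]
    have e1 : (coords b p (y + τ • (b 0 + α i • b 1))).1 = (coords b p y).1 + τ := by
      simp only [coords]
      rw [add_sub_right_comm, inner_add_right, real_inner_smul_right, inner_add_right,
        real_inner_smul_right, h00, h01]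
      ring
    have e2 : (coords b p (y + τ • (b 0 + α i • b 1))).2 = (coords b p y).2 + τ * α i := by
      simp only [coords]
      rw [add_sub_right_comm, inner_add_right, real_inner_smul_right, inner_add_right,
        real_inner_smul_right, h10, h11]
      ring
    rw [e1, e2]
    obtain ⟨h1, h2⟩ := hy
    refine ⟨by linarith [h1.1], ?_, ?_⟩
    · linarith [h2.1]
    · linarith [h2.2]
  · have hSvol : ∀ i, volume (S i) = ENNReal.ofReal (w * h) := by
      intro i
      have hstrip := volume_strip (h := h) hw.le (fun t => β i + α i * t) (by fun_prop)
      rw [← hstrip, ← hψ.measure_preimage]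
      · congr 1
        ext y
        exact memS i y
      · refine IsClosed.measurableSet ?_ |>.nullMeasurableSet
        exact (isClosed_Icc.preimage continuous_fst).inter
          ((isClosed_le (f := fun q : ℝ × ℝ => β i + α i * q.1 - w) (g := Prod.snd) (by fun_prop)
            (by fun_prop)).inter (isClosed_le (f := Prod.snd)
              (g := fun q : ℝ × ℝ => β i + α i * q.1) (by fun_prop) (by fun_prop)))
    rw [measure_iUnion hSdisj fun i => (hSc i).measurableSet]
    simp only [hSvol]
    rw [tsum_fintype, Finset.sum_const, nsmul_eq_mul, Finset.card_univ, ← ENNReal.ofReal_natCast,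
      ← ENNReal.ofReal_mul (by positivity), ← mul_assoc, hcard]
    congr 1
    ring
  · refine le_trans ?_ hvol
    refine le_trans (measure_mono ?_) (hψ.measure_preimage_le _)
    rintro y ⟨hyR, hy⟩
    obtain ⟨i, hyT, hyS⟩ := mem_iUnion.1 hy
    rw [memT] at hyT
    rw [memS] at hyS
    refine ⟨⟨?_, hyR⟩, i, hyT.2⟩
    by_contra hcon
    exact hyS ⟨⟨hyT.1, not_lt.1 hcon⟩, hyT.2⟩

/-! ### Filling the domain by sources -/

/-- A countable cover up to a null set has a finite subfamily covering up to a small set. -/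
theorem exists_finset_measure_diff_lt {X ι : Type*} [MeasurableSpace X] {μ : Measure X}
    {Ω : Set X} (hfin : μ Ω ≠ ⊤) (hΩ : MeasurableSet Ω) {u : Set ι} (hu : u.Countable)
    {B : ι → Set X} (hB : ∀ a ∈ u, MeasurableSet (B a))
    (hcov : μ (Ω \ ⋃ a ∈ u, B a) = 0) {ε : ENNReal} (hε : 0 < ε) :
    ∃ F : Finset ι, ↑F ⊆ u ∧ μ (Ω \ ⋃ a ∈ F, B a) < ε := by
  classical
  have := hu.to_subtype
  have hanti : Antitone fun F : Finset u => Ω \ ⋃ a ∈ F, B a.1 := by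
    intro F G hFG
    exact sdiff_subset_sdiff_right (biUnion_subset_biUnion_left hFG)
  have hmeas : ∀ F : Finset u, NullMeasurableSet (Ω \ ⋃ a ∈ F, B a.1) μ := fun F =>
    (hΩ.diff (Finset.measurableSet_biUnion _ fun (a : u) _ => hB a a.2)).nullMeasurableSet
  have htend := tendsto_measure_iInter_atTop (μ := μ) hmeas hanti
    ⟨∅, ne_top_of_le_ne_top hfin (measure_mono sdiff_subset)⟩
  have hzero : μ (⋂ F : Finset u, Ω \ ⋃ a ∈ F, B a.1) = 0 := by
    refine measure_mono_null ?_ hcov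
    intro x hx
    rw [mem_iInter] at hx
    refine ⟨(hx ∅).1, fun hxu => ?_⟩
    obtain ⟨a, hau, hxa⟩ := mem_iUnion₂.1 hxu
    exact (hx {⟨a, hau⟩}).2 (by simpa using hxa)
  rw [hzero] at htend
  obtain ⟨F, hF⟩ := (htend.eventually (gt_mem_nhds hε)).exists
  refine ⟨F.image Subtype.val, by simp, ?_⟩
  simpa using hF

/-- For any direction field `e` there are finitely many disjoint small open pieces `O j` that fill
`Ω` up to a set of measure `ε`, such that from each piece one can move in a direction `v j` close to
`e (p j)` without meeting the other pieces. The pieces are the parallelograms of disjoint combs,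
minus the half-strips of all other parallelograms. -/
theorem exists_sources {Ω : Set Plane} (hopen : IsOpen Ω) (hbdd : Bornology.IsBounded Ω)
    {e : Plane → Plane} (he : ∀ p, ‖e p‖ = 1) {ρ : Plane → ℝ} (hρ : ∀ p ∈ Ω, 0 < ρ p)
    {κ ε : ℝ} (hκ : 0 < κ) (hκ1 : κ ≤ 1) (hε : 0 < ε) :
    ∃ (J : Type) (_ : Finite J) (p v : J → Plane) (O : J → Set Plane),
      (∀ j, p j ∈ Ω) ∧ (∀ j, inner ℝ (e (p j)) (v j) = 1 ∧ ‖v j‖ ^ 2 ≤ 1 + κ ^ 2) ∧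
      (∀ j, IsOpen (O j) ∧ HasLinearFrontier (O j)) ∧
      (∀ j, O j ⊆ Metric.closedBall (p j) (ρ (p j))) ∧
      (Pairwise fun j k => Disjoint (O j) (O k)) ∧
      (∀ j k, j ≠ k → ∀ y ∈ O j, ∀ τ : ℝ, 0 ≤ τ → y + τ • v j ∉ O k) ∧
      volume (Ω \ ⋃ j, O j) ≤ ENNReal.ofReal ε := by
  classical
  set R : ℝ := Metric.diam Ω with hR
  have hΩfin : volume Ω ≠ ⊤ := hbdd.measure_lt_top.ne
  set V : ℝ := (volume Ω).toReal with hV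
  have hV0 : 0 ≤ V := ENNReal.toReal_nonneg
  set ε₁ : ℝ := ε / (2 * (V + 1)) with hε₁
  have hε₁0 : 0 < ε₁ := by positivity
  set c : ℝ := ε₁ * κ / (2 * (2 + ε₁)) with hc
  have hc0 : 0 < c := by positivity
  choose ι hι v S T hv hS hT hSball hSdisj hray hSvol hTvol using
    fun (p : Plane) (h : {h : ℝ // 0 < h}) => exists_comb R hκ hκ1 hε₁0 h.2 p (he p)
  set B : Plane × {h : ℝ // 0 < h} → Set Plane := fun a => ⋃ i, S a.1 a.2 i with hB
  have hBclosed : ∀ a, IsClosed (B a) := fun a =>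
    isClosed_iUnion_of_finite fun i => (hS a.1 a.2 i).1
  have hBvol : ∀ a, volume (B a) = ENNReal.ofReal (c * (a.2 : ℝ) ^ 2) := fun a => hSvol a.1 a.2
  obtain ⟨u, hut, hucount, hudisj, hucov⟩ := Vitali.exists_disjoint_covering_ae
    (volume : Measure Plane) Ω
    {a : Plane × {h : ℝ // 0 < h} | a.1 ∈ Ω ∧ 2 * (a.2 : ℝ) ≤ ρ a.1 ∧
      Metric.closedBall a.1 (2 * (a.2 : ℝ)) ⊆ Ω}
    ((36 / c).toNNReal * (volume (Metric.ball (0 : Plane) 1)).toNNReal)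
    (fun a => 2 * (a.2 : ℝ)) (fun a => a.1) B
    (fun a _ => iUnion_subset fun i => hSball a.1 a.2 i)
    (by
      intro a _
      have ha := a.2.2
      have hunit : volume (Metric.ball (0 : Plane) 1) ≠ ⊤ := measure_ball_lt_top.ne
      rw [Measure.addHaar_closedBall _ _ (by positivity), hBvol, ENNReal.coe_mul,
        ENNReal.coe_toNNReal hunit, mul_right_comm]
      gcongr
      rw [← ENNReal.ofReal, ← ENNReal.ofReal_mul (by positivity)]
      apply ENNReal.ofReal_le_ofReal
      rw [finrank_euclideanSpace_fin]
      apply le_of_eq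
      field_simp
      ring)
    (by
      intro a _
      -- a set without interior points and with linear boundary would be null
      by_contra hemp
      rw [not_nonempty_iff_eq_empty] at hemp
      have hnull : volume (B a) = 0 := by
        have := hι a.1 a.2
        refine measure_iUnion_null_iff.2 fun i => ?_
        refine measure_mono_null ?_ (hS a.1 a.2 i).2.volume_frontier
        intro y hy
        refine ⟨subset_closure hy, fun hyi => ?_⟩
        have := interior_mono (subset_iUnion (fun i => S a.1 a.2 i) i) hyi
        exact hemp.subset this
      rw [hBvol, ENNReal.ofReal_eq_zero] at hnull
      have := a.2.2
      have : 0 < c * (a.2 : ℝ) ^ 2 := by positivity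
      linarith)
    (fun a _ => hBclosed a)
    (by
      intro x hx ε' hε'
      obtain ⟨η, hη, hball⟩ := Metric.isOpen_iff.1 hopen x hx
      have hρx := hρ x hx
      set h : ℝ := min (min ε' (ρ x)) (η / 2) / 2 with hh
      have hh0 : 0 < h := by positivity
      have h1 : 2 * h ≤ min ε' (ρ x) := by
        have := min_le_left (min ε' (ρ x)) (η / 2)
        rw [hh]; linarith
      have h2 : 2 * h < η := by
        have := min_le_right (min ε' (ρ x)) (η / 2)
        rw [hh]; linarith
      exact ⟨(x, ⟨h, hh0⟩), ⟨hx, h1.trans (min_le_right _ _),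
        (Metric.closedBall_subset_ball h2).trans hball⟩, h1.trans (min_le_left _ _), rfl⟩)
  obtain ⟨F, hFu, hF⟩ := exists_finset_measure_diff_lt hΩfin hopen.measurableSet hucount
    (fun a _ => (hBclosed a).measurableSet) hucov (ε := ENNReal.ofReal (ε / 2))
    (by rw [ENNReal.ofReal_pos]; positivity)
  have : ∀ a : F, Finite (ι a.1.1 a.1.2) := fun a => hι _ _
  let SJ : (Σ a : F, ι a.1.1 a.1.2) → Set Plane := fun j => S j.1.1.1 j.1.1.2 j.2
  let TJ : (Σ a : F, ι a.1.1 a.1.2) → Set Plane := fun j => T j.1.1.1 j.1.1.2 j.2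
  let O : (Σ a : F, ι a.1.1 a.1.2) → Set Plane := fun j =>
    interior (SJ j) ∩ ⋂ k : {k // k ≠ j}, (TJ k)ᶜ
  have hSJdisj : ∀ j k, j ≠ k → Disjoint (SJ j) (SJ k) := by
    rintro ⟨a, i⟩ ⟨b, k⟩ hjk
    by_cases hab : a = b
    · subst hab
      exact hSdisj _ _ fun hik => hjk (congrArg (Sigma.mk a) hik)
    · refine (hudisj (hFu a.2) (hFu b.2) fun h => hab (Subtype.ext h)).mono ?_ ?_
      · exact subset_iUnion (fun i => S a.1.1 a.1.2 i) i
      · exact subset_iUnion (fun i => S b.1.1 b.1.2 i) k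
  have hOS : ∀ j, O j ⊆ SJ j := fun j => inter_subset_left.trans interior_subset
  refine ⟨Σ a : F, ι a.1.1 a.1.2, inferInstance, fun j => j.1.1.1,
    fun j => v j.1.1.1 j.1.1.2 j.2, O, ?_, ?_, ?_, ?_, ?_, ?_, ?_⟩
  · intro j
    exact (hut (hFu j.1.2)).1
  · intro j
    exact hv _ _ _
  · intro j
    constructor
    · exact isOpen_interior.inter (isOpen_iInter_of_finite fun k => (hT _ _ _).1.isOpen_compl)
    · exact (hS _ _ _).2.interior.inter (HasLinearFrontier.iInter fun k => (hT _ _ _).2.compl)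
  · intro j
    exact (hOS j).trans ((hSball _ _ _).trans
      (Metric.closedBall_subset_closedBall (hut (hFu j.1.2)).2.1))
  · intro j k hjk
    exact (hSJdisj j k hjk).mono (hOS j) (hOS k)
  · intro j k hjk y hy τ hτ hyk
    exact mem_iInter.1 hyk.2 ⟨j, hjk⟩ (hray _ _ _ y (hOS j hy) τ hτ)
  · have hsub : Ω \ ⋃ j, O j ⊆ (Ω \ ⋃ a ∈ F, B a) ∪ ((⋃ j, frontier (SJ j)) ∪
        ⋃ a ∈ F, ({y | inner ℝ (e a.1) (y - a.1) ≤ R} ∩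
          ⋃ i, T a.1 a.2 i \ S a.1 a.2 i)) := by
      rintro x ⟨hxΩ, hxO⟩
      by_cases hxB : x ∈ ⋃ a ∈ F, B a
      swap
      · exact Or.inl ⟨hxΩ, hxB⟩
      right
      obtain ⟨a, haF, hxa⟩ := mem_iUnion₂.1 hxB
      obtain ⟨i, hxi⟩ := mem_iUnion.1 hxa
      set j : Σ a : F, ι a.1.1 a.1.2 := ⟨⟨a, haF⟩, i⟩ with hj
      by_cases hfr : x ∈ interior (SJ j)
      swap
      · exact Or.inl (mem_iUnion.2 ⟨j, subset_closure hxi, hfr⟩)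
      right
      have hex : ∃ k, k ≠ j ∧ x ∈ TJ k := by
        by_contra hno
        push Not at hno
        exact hxO (mem_iUnion.2 ⟨j, hfr, mem_iInter.2 fun k => hno k k.2⟩)
      obtain ⟨k, hkj, hxk⟩ := hex
      have hxSk : x ∉ SJ k := fun h => Set.disjoint_left.1 (hSJdisj k j hkj) h hxi
      refine mem_iUnion₂.2 ⟨k.1.1, k.1.2, ?_, mem_iUnion.2 ⟨k.2, hxk, hxSk⟩⟩
      have hk := (hut (hFu k.1.2)).1
      calc inner ℝ (e k.1.1.1) (x - k.1.1.1) ≤ ‖e k.1.1.1‖ * ‖x - k.1.1.1‖ :=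
            real_inner_le_norm _ _
        _ = dist x k.1.1.1 := by rw [he, one_mul, dist_eq_norm]
        _ ≤ R := Metric.dist_le_diam_of_mem hbdd hxΩ hk
    have hnull : volume (⋃ j, frontier (SJ j)) = 0 :=
      measure_iUnion_null_iff.2 fun j => (hS _ _ _).2.volume_frontier
    have hsum : ∑ a ∈ F, volume (B a) ≤ volume Ω := by
      rw [← measure_biUnion_finset (hudisj.subset hFu) fun a _ => (hBclosed a).measurableSet]
      refine measure_mono (iUnion₂_subset fun a ha => ?_)
      exact (iUnion_subset fun i => hSball a.1 a.2 i).trans (hut (hFu ha)).2.2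
    have htails : volume (⋃ a ∈ F, ({y | inner ℝ (e a.1) (y - a.1) ≤ R} ∩
          ⋃ i, T a.1 a.2 i \ S a.1 a.2 i)) ≤ ENNReal.ofReal (ε / 2) := by
      refine (measure_biUnion_finset_le _ _).trans ?_
      have h1 : ∀ a ∈ F, volume ({y | inner ℝ (e a.1) (y - a.1) ≤ R} ∩
          ⋃ i, T a.1 a.2 i \ S a.1 a.2 i) ≤ ENNReal.ofReal ε₁ * volume (B a) := by
        intro a _
        rw [hBvol, ← ENNReal.ofReal_mul hε₁0.le]
        exact hTvol a.1 a.2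
      refine (Finset.sum_le_sum h1).trans ?_
      rw [← Finset.mul_sum]
      refine (mul_le_mul_right hsum _).trans ?_
      rw [← ENNReal.ofReal_toReal hΩfin, ← ENNReal.ofReal_mul hε₁0.le]
      apply ENNReal.ofReal_le_ofReal
      rw [← hV, hε₁, div_mul_eq_mul_div, div_le_div_iff₀ (by positivity) (by positivity)]
      nlinarith
    calc volume (Ω \ ⋃ j, O j) ≤ _ := measure_mono hsub
      _ ≤ _ := measure_union_le _ _
      _ ≤ ENNReal.ofReal (ε / 2) + (0 + ENNReal.ofReal (ε / 2)) := by
        gcongr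
        refine (measure_union_le _ _).trans ?_
        rw [hnull]
        gcongr
      _ = ENNReal.ofReal ε := by
        rw [zero_add, ← ENNReal.ofReal_add (by positivity) (by positivity), add_halves]

/-! ### Piecewise affine functions -/

open Classical in
/-- The function equal to `⟪g j, y⟫ + k j` on `O j` for each `j`, and to `0` off all the `O j`.
It is meant for disjoint sets `O j`. -/
noncomputable def piecewiseAffine {J : Type*} (O : J → Set Plane) (g : J → Plane) (k : J → ℝ)
    (y : Plane) : ℝ :=
  if h : ∃ j, y ∈ O j then inner ℝ (g h.choose) y + k h.choose else 0

section PiecewiseAffine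

variable {J : Type*} {O : J → Set Plane} {g : J → Plane} {k : J → ℝ}

theorem piecewiseAffine_of_mem (hdisj : Pairwise fun i j => Disjoint (O i) (O j)) {j : J}
    {y : Plane} (hy : y ∈ O j) : piecewiseAffine O g k y = inner ℝ (g j) y + k j := by
  have h : ∃ j, y ∈ O j := ⟨j, hy⟩
  have hj : h.choose = j := by
    by_contra hne
    exact Set.disjoint_left.1 (hdisj hne) h.choose_spec hy
  rw [piecewiseAffine, dif_pos h, hj]

theorem piecewiseAffine_of_notMem {y : Plane} (hy : ∀ j, y ∉ O j) :
    piecewiseAffine O g k y = 0 :=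
  dif_neg (not_exists.2 hy)

theorem piecewiseAffine_eventuallyEq (hdisj : Pairwise fun i j => Disjoint (O i) (O j)) {j : J}
    (hO : IsOpen (O j)) {y : Plane} (hy : y ∈ O j) :
    piecewiseAffine O g k =ᶠ[𝓝 y] fun z => inner ℝ (g j) z + k j := by
  filter_upwards [hO.mem_nhds hy] with z hz
  exact piecewiseAffine_of_mem hdisj hz

theorem gradient_piecewiseAffine (hdisj : Pairwise fun i j => Disjoint (O i) (O j)) {j : J}
    (hO : IsOpen (O j)) {y : Plane} (hy : y ∈ O j) :
    gradient (piecewiseAffine O g k) y = g j := by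
  have h : HasGradientAt (fun z => inner ℝ (g j) z + k j) (g j) y := by
    rw [hasGradientAt_iff_hasFDerivAt]
    exact ((innerSL ℝ (g j)).hasFDerivAt (x := y)).add_const (k j)
  have h' : HasGradientAt (piecewiseAffine O g k) (g j) y := by
    rw [hasGradientAt_iff_hasFDerivAt] at h ⊢
    exact h.congr_of_eventuallyEq (piecewiseAffine_eventuallyEq hdisj hO hy)
  exact h'.gradient

/-- A nonnegative function has zero gradient (possibly as a junk value) where it vanishes. -/
theorem gradient_eq_zero_of_nonneg {u : Plane → ℝ} (hu : ∀ y, 0 ≤ u y) {x : Plane}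
    (hx : u x = 0) : gradient u x = 0 := by
  have hmin : IsLocalMin u x := Eventually.of_forall fun y => by rw [hx]; exact hu y
  rw [gradient, hmin.fderiv_eq_zero, map_zero]

theorem isPiecewiseSmooth_piecewiseAffine [Finite J] (r : ℕ∞) {Ω : Set Plane}
    (hΩ : Bornology.IsBounded Ω) (hO : ∀ j, IsOpen (O j) ∧ HasLinearFrontier (O j))
    (hdisj : Pairwise fun i j => Disjoint (O i) (O j)) :
    IsPiecewiseSmooth r Ω (piecewiseAffine O g k) := by
  choose A hAfin hAline hAsub using fun j => (hO j).2
  choose! Γ hΓarc hΓsub hΓcov using fun l (hl : IsLine l) => hl.exists_arc r hΩ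
  have hline : ∀ l ∈ ⋃ j, A j, IsLine l := fun l hl =>
    let ⟨j, hj⟩ := mem_iUnion.1 hl
    hAline j l hj
  refine ⟨Γ '' ⋃ j, A j, (finite_iUnion hAfin).image Γ, ?_, ?_, ?_⟩
  · rintro _ ⟨l, hl, rfl⟩
    exact hΓarc l (hline l hl)
  · rintro _ ⟨l, hl, rfl⟩ _ ⟨l', hl', rfl⟩ hne
    exact ((hline l hl).finite_inter (hline l' hl') fun h => hne (by rw [h])).subset
      (inter_subset_inter (hΓsub l (hline l hl)) (hΓsub l' (hline l' hl')))
  · intro x hxΩ hx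
    by_contra hxA
    apply hx
    have hfr : ∀ j, x ∉ frontier (O j) := by
      intro j hj
      obtain ⟨l, hl, hxl⟩ := hAsub j hj
      have hl' : l ∈ ⋃ j, A j := mem_iUnion.2 ⟨j, hl⟩
      exact hxA ⟨Γ l, mem_image_of_mem _ hl', hΓcov l (hline l hl') ⟨hxl, hxΩ⟩⟩
    have hev : ∀ᶠ y in 𝓝 x, ∀ j, y ∉ frontier (O j) :=
      eventually_all.2 fun j => isClosed_frontier.isOpen_compl.mem_nhds (hfr j)
    filter_upwards [hev] with y hy
    by_cases hmem : ∃ j, y ∈ O j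
    · obtain ⟨j, hj⟩ := hmem
      exact (((innerSL ℝ (g j)).contDiff.add contDiff_const).contDiffAt).congr_of_eventuallyEq
        (piecewiseAffine_eventuallyEq hdisj (hO j).1 hj)
    · push Not at hmem
      have hcl : ∀ j, y ∉ closure (O j) := fun j h =>
        hy j ⟨h, fun hi => hmem j (interior_subset hi)⟩
      have hev' : ∀ᶠ z in 𝓝 y, ∀ j, z ∉ closure (O j) :=
        eventually_all.2 fun j => isClosed_closure.isOpen_compl.mem_nhds (hcl j)
      refine (contDiffAt_const (c := (0 : ℝ))).congr_of_eventuallyEq ?_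
      filter_upwards [hev'] with z hz
      exact piecewiseAffine_of_notMem fun j h => hz j (subset_closure h)

/-- The particle reflected at a point of `O j` travels in the direction `-g j`. If its path avoids
the other pieces and its height stays nonnegative over `Ω`, it misses the graph: over `O j` the
graph descends faster than the path, and elsewhere on the path the graph has height `0`. -/
theorem piecewiseAffine_mem_admissible [Finite J] (r : ℕ∞) {Ω : Set Plane} {M : ℝ} (hM : 0 ≤ M)
    (hΩ : Bornology.IsBounded Ω) (hO : ∀ j, IsOpen (O j) ∧ HasLinearFrontier (O j))
    (hdisj : Pairwise fun i j => Disjoint (O i) (O j))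
    (hval : ∀ j, ∀ y ∈ O j, 0 ≤ inner ℝ (g j) y + k j ∧ inner ℝ (g j) y + k j ≤ M)
    (hpath : ∀ i j, i ≠ j → ∀ y ∈ O i, ∀ t : ℝ, 0 < t → y - t • g i ∉ O j)
    (hheight : ∀ j, ∀ y ∈ O j, ∀ t : ℝ, 0 < t → y - t • g j ∈ closure Ω →
      0 ≤ inner ℝ (g j) y + k j + t * (1 / 2 * (1 - ‖g j‖ ^ 2))) :
    piecewiseAffine O g k ∈ admissible r Ω M := by
  have hbound : ∀ y, 0 ≤ piecewiseAffine O g k y ∧ piecewiseAffine O g k y ≤ M := by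
    intro y
    by_cases hy : ∃ j, y ∈ O j
    · obtain ⟨j, hj⟩ := hy
      rw [piecewiseAffine_of_mem hdisj hj]
      exact hval j y hj
    · rw [piecewiseAffine_of_notMem (not_exists.1 hy)]
      exact ⟨le_rfl, hM⟩
  refine ⟨isPiecewiseSmooth_piecewiseAffine r hΩ hO hdisj, ?_, fun y _ => hbound y⟩
  intro x _ _ t ht hxt
  by_cases hx : ∃ j, x ∈ O j
  · obtain ⟨j, hj⟩ := hx
    rw [gradient_piecewiseAffine hdisj (hO j).1 hj] at hxt ⊢
    rw [piecewiseAffine_of_mem hdisj hj, div_le_iff₀ ht]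
    by_cases hy : x - t • g j ∈ O j
    · rw [piecewiseAffine_of_mem hdisj hy, inner_sub_right, real_inner_smul_right,
        real_inner_self_eq_norm_sq]
      nlinarith [sq_nonneg ‖g j‖]
    · rw [piecewiseAffine_of_notMem fun i hi => ?_]
      · linarith [hheight j x hj t ht hxt]
      · rcases eq_or_ne j i with rfl | hne
        · exact hy hi
        · exact hpath j i hne x hj t ht hi
  · have hx0 : piecewiseAffine O g k x = 0 := piecewiseAffine_of_notMem (not_exists.1 hx)
    rw [gradient_eq_zero_of_nonneg (fun y => (hbound y).1) hx0]
    simp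

end PiecewiseAffine

/-! ### Distance to the boundary -/

theorem frontier_nonempty_of_isBounded {Ω : Set Plane} (hne : Ω.Nonempty)
    (hbdd : Bornology.IsBounded Ω) : (frontier Ω).Nonempty := by
  refine nonempty_frontier_iff.2 ⟨hne, fun h => ?_⟩
  rw [h] at hbdd
  exact NormedSpace.unbounded_univ ℝ Plane hbdd

theorem infDist_frontier_pos {Ω : Set Plane} (hopen : IsOpen Ω) (hbdd : Bornology.IsBounded Ω)
    {p : Plane} (hp : p ∈ Ω) : 0 < Metric.infDist p (frontier Ω) := by
  refine (isClosed_frontier.notMem_iff_infDist_pos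
    (frontier_nonempty_of_isBounded ⟨p, hp⟩ hbdd)).1 fun h => ?_
  rw [hopen.frontier_eq] at h
  exact h.2 hp

theorem infDist_frontier_le_diam {Ω : Set Plane} (hbdd : Bornology.IsBounded Ω) {p : Plane}
    (hp : p ∈ Ω) : Metric.infDist p (frontier Ω) ≤ Metric.diam (closure Ω) := by
  obtain ⟨z, hz⟩ := frontier_nonempty_of_isBounded ⟨p, hp⟩ hbdd
  exact (Metric.infDist_le_dist_of_mem hz).trans
    (Metric.dist_le_diam_of_mem hbdd.closure (subset_closure hp) hz.1)

/-- The direction towards a nearest boundary point of a convex set: no point of the set is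
farther in this direction than the boundary, by separation at the nearest boundary point. -/
theorem exists_direction {Ω : Set Plane} (hopen : IsOpen Ω) (hconv : Convex ℝ Ω)
    (hbdd : Bornology.IsBounded Ω) {p : Plane} (hp : p ∈ Ω) :
    ∃ e : Plane, ‖e‖ = 1 ∧
      ∀ y ∈ closure Ω, inner ℝ e (y - p) ≤ Metric.infDist p (frontier Ω) := by
  obtain ⟨z, hz, hdist⟩ := isClosed_frontier.exists_infDist_eq_dist
    (frontier_nonempty_of_isBounded ⟨p, hp⟩ hbdd) p
  have hzΩ : z ∉ Ω := by
    rw [hopen.frontier_eq] at hz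
    exact hz.2
  obtain ⟨f, hf⟩ := geometric_hahn_banach_open_point hconv hopen hzΩ
  obtain ⟨n, rfl⟩ := (InnerProductSpace.toDual ℝ Plane).surjective f
  simp only [InnerProductSpace.toDual_apply_apply] at hf
  have hn : 0 < ‖n‖ := by
    rw [norm_pos_iff]
    rintro rfl
    simpa using hf p hp
  refine ⟨‖n‖⁻¹ • n, by rw [norm_smul, norm_inv, norm_norm, inv_mul_cancel₀ hn.ne'], ?_⟩
  have hcl : ∀ y ∈ closure Ω, inner ℝ n y ≤ inner ℝ n z := fun y hy =>
    closure_minimal (fun y hy => (hf y hy).le)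
      (isClosed_le (f := fun y : Plane => inner ℝ n y) (by fun_prop) continuous_const) hy
  intro y hy
  rw [real_inner_smul_left, inv_mul_le_iff₀ hn, hdist, dist_comm, dist_eq_norm]
  calc inner ℝ n (y - p) ≤ inner ℝ n (z - p) := by
        rw [inner_sub_right, inner_sub_right]
        linarith [hcl y hy]
    _ ≤ ‖n‖ * ‖z - p‖ := real_inner_le_norm _ _

/-! ### The critical slope -/

/-- The slope `μ` for which a particle reflected from a surface of slope `μ` descends by `m` over
the horizontal distance `D`, that is, `(μ - 1 / μ) / 2 = m / D`. -/
noncomputable def criticalSlope (m D : ℝ) : ℝ := (m + √(m ^ 2 + D ^ 2)) / D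

section CriticalSlope

variable {m D : ℝ}

theorem criticalSlope_sq_sub_one (hm : 0 < m) (hD : 0 < D) :
    criticalSlope m D ^ 2 - 1 = 2 * m / D * criticalSlope m D := by
  have hq : √(m ^ 2 + D ^ 2) ^ 2 = m ^ 2 + D ^ 2 := Real.sq_sqrt (by positivity)
  rw [criticalSlope]
  field_simp
  linear_combination hq

theorem one_le_criticalSlope (hm : 0 < m) (hD : 0 < D) : 1 ≤ criticalSlope m D := by
  rw [criticalSlope, one_le_div hD]
  have : D ≤ √(m ^ 2 + D ^ 2) := Real.le_sqrt_of_sq_le (by nlinarith)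
  linarith

theorem criticalSlope_le (hm : 0 < m) (hD : 0 < D) : criticalSlope m D ≤ 2 * m / D + 1 := by
  have h1 := criticalSlope_sq_sub_one hm hD
  have h2 := one_le_criticalSlope hm hD
  by_contra hcon
  push Not at hcon
  have h3 : 0 < 2 * m / D := by positivity
  nlinarith

theorem one_div_one_add_criticalSlope_sq (hm : 0 < m) (hD : 0 < D) :
    1 / (1 + criticalSlope m D ^ 2) = 1 / 2 * (1 - m / √(m ^ 2 + D ^ 2)) := by
  have hq : √(m ^ 2 + D ^ 2) ^ 2 = m ^ 2 + D ^ 2 := Real.sq_sqrt (by positivity)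
  have hq0 : 0 < √(m ^ 2 + D ^ 2) := Real.sqrt_pos.2 (by positivity)
  set q := √(m ^ 2 + D ^ 2) with hqdef
  have h1 : 1 + criticalSlope m D ^ 2 = 2 * q * (q + m) / D ^ 2 := by
    rw [criticalSlope, ← hqdef]
    field_simp
    linear_combination -hq
  rw [h1]
  field_simp
  linear_combination -hq

/-- The optimal local resistance is Lipschitz in the height and in the distance, with constants of
order `1 / M`. -/
theorem div_sqrt_sub_div_sqrt_le {M d η : ℝ} (hm : 0 < m) (hmM : m ≤ M) (hd : 0 ≤ d)
    (hD : 0 ≤ D) (hη : 0 ≤ η) (hDd : D ≤ d + η) :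
    M / √(M ^ 2 + d ^ 2) - m / √(m ^ 2 + D ^ 2) ≤ (M - m + η) / M := by
  have hM : 0 < M := hm.trans_le hmM
  set A := √(M ^ 2 + d ^ 2) with hA
  set B := √(m ^ 2 + D ^ 2) with hB
  have hMA : M ≤ A := Real.le_sqrt_of_sq_le (by nlinarith)
  have hmB : m ≤ B := Real.le_sqrt_of_sq_le (by nlinarith)
  have hA0 : 0 < A := hM.trans_le hMA
  have hB0 : 0 < B := hm.trans_le hmB
  have hA2 : A ^ 2 = M ^ 2 + d ^ 2 := Real.sq_sqrt (by positivity)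
  have hdA : d ≤ A := Real.le_sqrt_of_sq_le (by nlinarith)
  have hBA : B ≤ A + η := by
    rw [hB]
    apply Real.sqrt_le_iff.2
    constructor
    · positivity
    · nlinarith
  have h1 : M / A - m / B = ((M - m) + m * (B - A) / B) / A := by field_simp; ring
  have h2 : m * (B - A) / B ≤ η := by
    rw [div_le_iff₀ hB0]
    nlinarith
  rw [h1]
  calc ((M - m) + m * (B - A) / B) / A ≤ (M - m + η) / A := by gcongr
    _ ≤ (M - m + η) / M := by
      have : 0 ≤ M - m := by linarith
      gcongr

end CriticalSlope

/-- The optimal local resistance at a point at distance `d(x)` from the boundary. -/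
noncomputable def localBound (Ω : Set Plane) (M : ℝ) (x : Plane) : ℝ :=
  1 / 2 * (1 - M / Real.sqrt (M ^ 2 + Metric.infDist x (frontier Ω) ^ 2))

theorem div_sqrt_le_one {M d : ℝ} (hM : 0 < M) : M / √(M ^ 2 + d ^ 2) ≤ 1 := by
  have h : M ≤ √(M ^ 2 + d ^ 2) := Real.le_sqrt_of_sq_le (by nlinarith [sq_nonneg d])
  exact (div_le_one (hM.trans_le h)).2 h

theorem localBound_nonneg {Ω : Set Plane} {M : ℝ} (hM : 0 < M) (x : Plane) :
    0 ≤ localBound Ω M x := by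
  have := div_sqrt_le_one (d := Metric.infDist x (frontier Ω)) hM
  rw [localBound]
  linarith

theorem localBound_le_half {Ω : Set Plane} {M : ℝ} (hM : 0 < M) (x : Plane) :
    localBound Ω M x ≤ 1 / 2 := by
  have : 0 ≤ M / √(M ^ 2 + Metric.infDist x (frontier Ω) ^ 2) := by positivity
  rw [localBound]
  linarith

theorem integrableOn_localBound {Ω : Set Plane} (hbdd : Bornology.IsBounded Ω) {M : ℝ}
    (hM : 0 < M) : IntegrableOn (localBound Ω M) Ω := by
  have hcont : Continuous (localBound Ω M) := by
    have h1 : Continuous fun x => Metric.infDist x (frontier Ω) := Metric.continuous_infDist_pt _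
    unfold localBound
    refine continuous_const.mul (continuous_const.sub (continuous_const.div (by fun_prop) ?_))
    intro x
    positivity
  exact (hcont.continuousOn.integrableOn_compact
    (Metric.isCompact_of_isClosed_isBounded isClosed_closure hbdd.closure)).mono_set
    subset_closure

/-! ### The upper bound for the infimum -/

/-- Take `u` affine on the pieces of `exists_sources`, for the direction field towards a nearest
boundary point, with values in `[M - η, M]` and such that a particle reflected from a piece
descends by at most `M - η` as long as it stays over `Ω`. -/
theorem exists_admissible_resistance_le (r : ℕ∞) {Ω : Set Plane} (hopen : IsOpen Ω)
    (hconv : Convex ℝ Ω) (hbdd : Bornology.IsBounded Ω) {M : ℝ} (hM : 0 < M) {ε : ℝ}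
    (hε : 0 < ε) : ∃ u ∈ admissible r Ω M, resistance Ω u ≤ phi Ω M + ε := by
  classical
  set d : Plane → ℝ := fun p => Metric.infDist p (frontier Ω) with hd
  have hd0 : ∀ p ∈ Ω, 0 < d p := fun p hp => infDist_frontier_pos hopen hbdd hp
  have hd0' : ∀ p, 0 ≤ d p := fun p => Metric.infDist_nonneg
  set K : ℝ := Metric.diam (closure Ω) with hK
  have hK0 : 0 ≤ K := Metric.diam_nonneg
  have hdK : ∀ p ∈ Ω, d p ≤ K := fun p hp => infDist_frontier_le_diam hbdd hp
  have hex : ∀ p, ∃ e : Plane, ‖e‖ = 1 ∧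
      (p ∈ Ω → ∀ y ∈ closure Ω, inner ℝ e (y - p) ≤ d p) := by
    intro p
    by_cases hp : p ∈ Ω
    · obtain ⟨e, he, hy⟩ := exists_direction hopen hconv hbdd hp
      exact ⟨e, he, fun _ => hy⟩
    · exact ⟨EuclideanSpace.single 0 1, by simp, fun h => (hp h).elim⟩
  choose e he hedir using hex
  have hΩfin : volume Ω ≠ ⊤ := hbdd.measure_lt_top.ne
  set V : ℝ := volume.real Ω with hV
  have hV0 : 0 ≤ V := measureReal_nonneg
  set ε₁ : ℝ := ε / (2 * (V + 1)) with hε₁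
  have hε₁0 : 0 < ε₁ := by positivity
  -- the loss of height, the tolerance in the directions and the size of the pieces
  set η : ℝ := min (M / 2) (M * ε₁ / 2) with hη
  have hη0 : 0 < η := by positivity
  have hηM : η ≤ M / 2 := min_le_left _ _
  have hηε : η ≤ M * ε₁ / 2 := min_le_right _ _
  set κ : ℝ := min 1 (M * ε₁ / (4 * (K + 1))) with hκ
  have hκ0 : 0 < κ := by positivity
  have hκ1 : κ ≤ 1 := min_le_left _ _
  have hκK : K * κ ≤ M * ε₁ / 4 := by
    have : κ ≤ M * ε₁ / (4 * (K + 1)) := min_le_right _ _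
    rw [le_div_iff₀ (by positivity)] at this
    nlinarith
  set ρ : Plane → ℝ := fun p => min (M * ε₁ / 16) (η / (2 * (2 * M / d p + 1))) with hρ
  have hρ0 : ∀ p, 0 < ρ p := by
    intro p
    have := hd0' p
    simp only [hρ]
    positivity
  obtain ⟨J, _, p, v, O, hpΩ, hv, hO, hOball, hOdisj, hpath, hvol⟩ :=
    exists_sources hopen hbdd he (fun p _ => hρ0 p) hκ0 hκ1 (half_pos hε)
  set m : ℝ := M - η with hm
  have hm0 : 0 < m := by linarith
  have hN1 : ∀ j, 1 ≤ ‖v j‖ := by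
    intro j
    have := real_inner_le_norm (e (p j)) (v j)
    rwa [(hv j).1, he, one_mul] at this
  have hN2 : ∀ j, ‖v j‖ ≤ 1 + κ := fun j =>
    abs_le_of_sq_le_sq' (by nlinarith [(hv j).2]) (by positivity) |>.2
  have hN0 : ∀ j, 0 < ‖v j‖ := fun j => one_pos.trans_le (hN1 j)
  -- an upper bound for the horizontal distance over which a reflected particle stays over `Ω`
  set D : J → ℝ := fun j => (d (p j) + ρ (p j)) * ‖v j‖ with hD
  have hdD : ∀ j, d (p j) ≤ D j := by
    intro j
    have h1 := (hρ0 (p j)).le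
    have h2 := hd0' (p j)
    have h3 := hN1 j
    simp only [hD]
    nlinarith
  have hD0 : ∀ j, 0 < D j := fun j => (hd0 _ (hpΩ j)).trans_le (hdD j)
  set μ : J → ℝ := fun j => criticalSlope m (D j) with hμ
  have hμ1 : ∀ j, 1 ≤ μ j := fun j => one_le_criticalSlope hm0 (hD0 j)
  have hμ0 : ∀ j, 0 < μ j := fun j => one_pos.trans_le (hμ1 j)
  have hμρ : ∀ j, 2 * (μ j * ρ (p j)) ≤ η := by
    intro j
    have hdj := hd0 _ (hpΩ j)
    have h1 : μ j ≤ 2 * M / d (p j) + 1 := by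
      refine (criticalSlope_le hm0 (hD0 j)).trans ?_
      have := hdD j
      gcongr
      linarith
    have h2 : ρ (p j) ≤ η / (2 * (2 * M / d (p j) + 1)) := min_le_right _ _
    rw [le_div_iff₀ (by positivity)] at h2
    have := hρ0 (p j)
    nlinarith
  set g : J → Plane := fun j => -((μ j / ‖v j‖) • v j) with hg
  have hgnorm : ∀ j, ‖g j‖ = μ j := by
    intro j
    have := hN0 j
    have := hμ0 j
    simp only [hg]
    rw [norm_neg, norm_smul, Real.norm_of_nonneg (by positivity)]
    field_simp
  set k : J → ℝ := fun j => M - μ j * ρ (p j) - inner ℝ (g j) (p j) with hk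
  -- the heights on the pieces lie in `[m, M]`
  have hheight : ∀ j, ∀ y ∈ O j, m ≤ inner ℝ (g j) y + k j ∧ inner ℝ (g j) y + k j ≤ M := by
    intro j y hy
    have h1 := hOball j hy
    rw [mem_closedBall_iff_norm] at h1
    have h2 : inner ℝ (g j) y + k j = M - μ j * ρ (p j) + inner ℝ (g j) (y - p j) := by
      simp only [hk, inner_sub_right]
      ring
    have h3 : |inner ℝ (g j) (y - p j)| ≤ μ j * ρ (p j) := by
      refine (abs_real_inner_le_norm _ _).trans ?_
      rw [hgnorm]
      have := hμ0 j
      gcongr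
    have h4 := hμρ j
    rw [abs_le] at h3
    rw [h2]
    constructor <;> linarith [h3.1, h3.2]
  have hstep : ∀ j y (t : ℝ), y - t • g j = y + (t * (μ j / ‖v j‖)) • v j := by
    intro j y t
    simp only [hg]
    module
  have hadm : piecewiseAffine O g k ∈ admissible r Ω M := by
    refine piecewiseAffine_mem_admissible r hM.le hbdd hO hOdisj ?_ ?_ ?_
    · exact fun j y hy => ⟨hm0.le.trans (hheight j y hy).1, (hheight j y hy).2⟩
    · intro i j hij y hy t ht
      rw [hstep]
      have := hN0 i
      have := hμ0 i
      exact hpath i j hij y hy _ (by positivity)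
    · intro j y hy t ht hyt
      have h1 := (hheight j y hy).1
      rw [hstep] at hyt
      have h2 := hedir (p j) (hpΩ j) _ hyt
      rw [add_sub_right_comm, inner_add_right, real_inner_smul_right, (hv j).1, mul_one] at h2
      have h3 : -ρ (p j) ≤ inner ℝ (e (p j)) (y - p j) := by
        have h4 := hOball j hy
        rw [mem_closedBall_iff_norm] at h4
        have h5 := abs_real_inner_le_norm (e (p j)) (y - p j)
        rw [he, one_mul, abs_le] at h5
        linarith [h5.1]
      have h4 : t * μ j ≤ D j := by
        have h5 : t * (μ j / ‖v j‖) ≤ d (p j) + ρ (p j) := by linarith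
        rw [← mul_div_assoc, div_le_iff₀ (hN0 j)] at h5
        exact h5
      have h5 := criticalSlope_sq_sub_one hm0 (hD0 j)
      have h6 : t * (μ j ^ 2 - 1) ≤ 2 * m := by
        have e1 : t * (μ j ^ 2 - 1) = 2 * m / D j * (t * μ j) := by
          simp only [hμ]
          rw [h5]
          ring
        rw [e1, div_mul_eq_mul_div, div_le_iff₀ (hD0 j)]
        have := hm0.le
        gcongr
      rw [hgnorm]
      linarith
  refine ⟨_, hadm, ?_⟩
  have hpoint : ∀ j, ∀ y ∈ O j, y ∈ Ω →
      1 / (1 + ‖gradient (piecewiseAffine O g k) y‖ ^ 2) ≤ localBound Ω M y + ε₁ := by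
    intro j y hy hyΩ
    rw [gradient_piecewiseAffine hOdisj (hO j).1 hy, hgnorm]
    simp only [hμ]
    rw [one_div_one_add_criticalSlope_sq hm0 (hD0 j)]
    have h1 : d (p j) ≤ d y + ρ (p j) := by
      have h2 := hOball j hy
      rw [Metric.mem_closedBall, dist_comm] at h2
      have h3 : d (p j) ≤ d y + dist (p j) y := Metric.infDist_le_infDist_add_dist
      linarith
    have h2 : D j ≤ d y + M * ε₁ / 2 := by
      have h3 : ρ (p j) ≤ M * ε₁ / 16 := min_le_left _ _
      have h4 := hN2 j
      have h5 := hN0 j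
      have h6 : D j ≤ (d y + 2 * ρ (p j)) * (1 + κ) := by
        have h7 := hρ0 (p j)
        have h8 := hd0' y
        exact mul_le_mul (by linarith) h4 h5.le (by linarith)
      have h7 : κ * d y ≤ M * ε₁ / 4 := by
        have := hdK y hyΩ
        nlinarith
      have := hρ0 (p j)
      nlinarith
    have h3 := div_sqrt_sub_div_sqrt_le hm0 (by linarith : m ≤ M) (hd0' y) (hD0 j).le
      (by positivity : 0 ≤ M * ε₁ / 2) h2
    have h4 : (M - m + M * ε₁ / 2) / M ≤ ε₁ := by
      rw [div_le_iff₀ hM]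
      linarith
    have h5 : localBound Ω M y = 1 / 2 * (1 - M / √(M ^ 2 + d y ^ 2)) := rfl
    rw [h5]
    linarith
  set N : Set Plane := Ω \ ⋃ j, O j with hN
  have hNmeas : MeasurableSet N :=
    hopen.measurableSet.diff (MeasurableSet.iUnion fun j => (hO j).1.measurableSet)
  have hint1 : IntegrableOn (localBound Ω M) Ω := integrableOn_localBound hbdd hM
  have hint2 : IntegrableOn (fun _ : Plane => ε₁) Ω := integrableOn_const hΩfin
  have hint3 : IntegrableOn (N.indicator fun _ : Plane => (1 : ℝ)) Ω :=
    (integrableOn_const (C := (1 : ℝ)) hΩfin).indicator hNmeas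
  have hNvol : volume.real N ≤ ε / 2 := ENNReal.toReal_le_of_le_ofReal (by positivity) hvol
  calc resistance Ω (piecewiseAffine O g k)
      ≤ ∫ x in Ω, (localBound Ω M x + ε₁ + N.indicator (fun _ => (1 : ℝ)) x) := by
        refine integral_mono_of_nonneg (ae_of_all _ fun x => by positivity)
          ((hint1.add hint2).add hint3) ?_
        filter_upwards [ae_restrict_mem hopen.measurableSet] with x hx
        by_cases hxO : ∃ j, x ∈ O j
        · obtain ⟨j, hj⟩ := hxO
          have h1 := hpoint j x hj hx
          have h2 : 0 ≤ N.indicator (fun _ => (1 : ℝ)) x :=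
            indicator_nonneg (fun _ _ => zero_le_one) x
          linarith
        · have hxN : x ∈ N := ⟨hx, by simpa using hxO⟩
          rw [indicator_of_mem hxN]
          have h1 := localBound_nonneg (Ω := Ω) hM x
          have h2 : 1 / (1 + ‖gradient (piecewiseAffine O g k) x‖ ^ 2) ≤ 1 := by
            rw [div_le_one (by positivity)]
            linarith [sq_nonneg ‖gradient (piecewiseAffine O g k) x‖]
          linarith
    _ = phi Ω M + ε₁ * V + volume.real N := by
        have e1 : ∫ x in Ω, (localBound Ω M x + ε₁ + N.indicator (fun _ => (1 : ℝ)) x) =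
            (∫ x in Ω, (localBound Ω M x + ε₁)) + ∫ x in Ω, N.indicator (fun _ => (1 : ℝ)) x :=
          integral_add (hint1.add hint2) hint3
        have e2 : ∫ x in Ω, (localBound Ω M x + ε₁) = phi Ω M + ∫ _ in Ω, ε₁ :=
          integral_add hint1 hint2
        rw [e1, e2, setIntegral_const, smul_eq_mul, mul_comm, integral_indicator_const 1 hNmeas,
          measureReal_restrict_apply hNmeas, inter_eq_left.2 sdiff_subset, smul_eq_mul, mul_one]
    _ ≤ phi Ω M + ε := by
        have h1 : ε₁ * V ≤ ε / 2 := by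
          rw [hε₁, div_mul_eq_mul_div, div_le_div_iff₀ (by positivity) (by positivity)]
          nlinarith
        linarith

/-! ### The lower bound -/

/-- The particle reflected at a regular point with gradient `g` descends at the rate
`(‖g‖ - 1 / ‖g‖) / 2`, at least over the distance to the boundary, and its total descent is
at most `M`. -/
theorem localBound_le {r : ℕ∞} {Ω : Set Plane} {M : ℝ} (hM : 0 < M) {u : Plane → ℝ}
    (hu : u ∈ admissible r Ω M) {x : Plane} (hx : x ∈ Ω) (hreg : IsRegularPoint r u x)
    (hball : Metric.closedBall x (Metric.infDist x (frontier Ω)) ⊆ closure Ω)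
    (hd : 0 < Metric.infDist x (frontier Ω)) :
    localBound Ω M x ≤ 1 / (1 + ‖gradient u x‖ ^ 2) := by
  set d := Metric.infDist x (frontier Ω) with hddef
  set g := ‖gradient u x‖ with hg
  have hg0 : 0 ≤ g := norm_nonneg _
  rcases le_or_gt g 1 with hg1 | hg1
  · refine (localBound_le_half hM x).trans ?_
    rw [div_le_div_iff₀ (by norm_num) (by positivity)]
    nlinarith
  have hgpos : 0 < g := by linarith
  set t : ℝ := d / g with ht
  have ht0 : 0 < t := by positivity
  have htg : t * g = d := by rw [ht]; field_simp
  have hmem : x - t • gradient u x ∈ closure Ω := by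
    apply hball
    rw [mem_closedBall_iff_norm, sub_sub_cancel_left, norm_neg, norm_smul, ← hg,
      Real.norm_of_nonneg ht0.le, htg]
  have hsic := hu.2.1 x hx hreg t ht0 hmem
  have h1 := hu.2.2 _ hmem
  have h2 := hu.2.2 x (subset_closure hx)
  rw [div_le_iff₀ ht0, ← hg] at hsic
  have h3 : t * (g ^ 2 - 1) ≤ 2 * M := by nlinarith [h1.1, h2.2]
  have h4 : d * (g ^ 2 - 1) ≤ 2 * M * g := by
    have : t * g * (g ^ 2 - 1) ≤ 2 * M * g := by nlinarith
    rwa [htg] at this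
  -- the critical slope is the positive root of the corresponding quadratic equation
  have h5 : g ≤ criticalSlope M d := by
    have h6 := criticalSlope_sq_sub_one hM hd
    have h7 := one_le_criticalSlope hM hd
    set c := criticalSlope M d with hc
    have h8 : d * (c ^ 2 - 1) = 2 * M * c := by rw [h6]; field_simp
    by_contra hcon
    push Not at hcon
    have h9 : d * (g ^ 2 - 1) * c ≤ 2 * M * g * c := by gcongr
    have h10 : d * (c ^ 2 - 1) * g = 2 * M * c * g := by rw [h8]
    have h11 : d * ((g - c) * (g * c + 1)) ≤ 0 := by nlinarith
    have h12 : 0 < d * ((g - c) * (g * c + 1)) := by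
      have : 0 < g - c := by linarith
      positivity
    linarith
  have h6 := one_div_one_add_criticalSlope_sq hM hd
  have h7 : localBound Ω M x = 1 / 2 * (1 - M / √(M ^ 2 + d ^ 2)) := rfl
  rw [h7, ← h6]
  gcongr

theorem IsSmoothArc.isCompact {r : ℕ∞} {Γ : Set Plane} (h : IsSmoothArc r Γ) : IsCompact Γ := by
  obtain ⟨γ, hγ, _, _, rfl⟩ := h
  exact isCompact_Icc.image hγ.continuous

theorem IsSmoothArc.volume_eq_zero {r : ℕ∞} (hr : 1 ≤ r) {Γ : Set Plane}
    (h : IsSmoothArc r Γ) : volume Γ = 0 := by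
  obtain ⟨γ, hγ, _, _, rfl⟩ := h
  exact volume_image_eq_zero (hγ.of_le (by exact_mod_cast hr)) _

theorem closedBall_infDist_frontier_subset {Ω : Set Plane} (hopen : IsOpen Ω)
    (hbdd : Bornology.IsBounded Ω) {x : Plane} (hx : x ∈ Ω) :
    Metric.closedBall x (Metric.infDist x (frontier Ω)) ⊆ closure Ω := by
  have hd := infDist_frontier_pos hopen hbdd hx
  have hball : Metric.ball x (Metric.infDist x (frontier Ω)) ⊆ Ω := by
    refine (convex_ball x _).isPreconnected.subset_of_closure_inter_subset hopen
      ⟨x, Metric.mem_ball_self hd, hx⟩ ?_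
    rintro z ⟨hzcl, hz⟩
    by_contra hzΩ
    have hzf : z ∈ frontier Ω := by
      rw [hopen.frontier_eq]
      exact ⟨hzcl, hzΩ⟩
    have := Metric.infDist_le_dist_of_mem (x := x) hzf
    rw [Metric.mem_ball, dist_comm] at hz
    linarith
  rw [← closure_ball x hd.ne']
  exact closure_mono hball

theorem phi_le_resistance {r : ℕ∞} (hr : 1 ≤ r) {Ω : Set Plane} (hopen : IsOpen Ω)
    (hbdd : Bornology.IsBounded Ω) {M : ℝ} (hM : 0 < M) {u : Plane → ℝ}
    (hu : u ∈ admissible r Ω M) : phi Ω M ≤ resistance Ω u := by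
  obtain ⟨A, hA, hAarc, _, hAcov⟩ := hu.1
  have hnull : volume (⋃₀ A) = 0 :=
    (measure_sUnion_null_iff hA.countable).2 fun Γ hΓ => (hAarc Γ hΓ).volume_eq_zero hr
  have hreg : ∀ᵐ x ∂volume.restrict Ω, x ∈ Ω ∧ IsRegularPoint r u x := by
    filter_upwards [ae_restrict_mem hopen.measurableSet,
      ae_restrict_of_ae (measure_eq_zero_iff_ae_notMem.1 hnull)] with x hx hxA
    exact ⟨hx, by_contra fun h => hxA (hAcov x hx h)⟩
  -- the integrand is continuous off the arcs, hence measurable up to a null set; without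
  -- integrability the resistance would have the junk value `0`
  set f : Plane → ℝ := fun x => 1 / (1 + ‖gradient u x‖ ^ 2) with hf
  set U : Set Plane := Ω \ ⋃₀ A with hU
  have hUopen : IsOpen U :=
    hopen.sdiff (by
      rw [sUnion_eq_biUnion]
      exact hA.isClosed_biUnion fun Γ hΓ => (hAarc Γ hΓ).isCompact.isClosed)
  have hcont : ContinuousOn f U := by
    intro x hx
    have hxr : IsRegularPoint r u x := by_contra fun h => hx.2 (hAcov x hx.1 h)
    have hC1 : ContDiffAt ℝ 1 u x := hxr.self_of_nhds.of_le (by exact_mod_cast hr)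
    have hfd : ContinuousAt (fderiv ℝ u) x := hC1.continuousAt_fderiv (by norm_num)
    have hgr : ContinuousAt (gradient u) x :=
      (InnerProductSpace.toDual ℝ Plane).symm.continuous.continuousAt.comp hfd
    refine ContinuousAt.continuousWithinAt ?_
    refine continuousAt_const.div (continuousAt_const.add (hgr.norm.pow 2)) ?_
    positivity
  have hUΩ : U =ᵐ[volume] Ω := sdiff_null_ae_eq_self hnull
  have hmeas : AEStronglyMeasurable f (volume.restrict Ω) := by
    rw [← Measure.restrict_congr_set hUΩ]
    exact hcont.aestronglyMeasurable hUopen.measurableSet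
  have hint : IntegrableOn f Ω := by
    have : IsFiniteMeasure (volume.restrict Ω) := ⟨by
      rw [Measure.restrict_apply_univ]
      exact hbdd.measure_lt_top⟩
    refine Integrable.of_bound hmeas 1 (ae_of_all _ fun x => ?_)
    rw [Real.norm_of_nonneg (by positivity), hf]
    simp only
    rw [div_le_one (by positivity)]
    linarith [sq_nonneg ‖gradient u x‖]
  refine integral_mono_ae (integrableOn_localBound hbdd hM) hint ?_
  filter_upwards [hreg] with x hx
  exact localBound_le hM hu hx.1 hx.2 (closedBall_infDist_frontier_subset hopen hbdd hx.1)
    (infDist_frontier_pos hopen hbdd hx.1)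

end SingleImpact

theorem theorem1 (r : ℕ∞) (hr : 1 ≤ r) (Ω : Set SingleImpact.Plane) (hopen : IsOpen Ω)
    (hconv : Convex ℝ Ω) (hbdd : Bornology.IsBounded Ω) (M : ℝ) (hM : 0 < M) :
    IsGLB (SingleImpact.resistance Ω '' SingleImpact.admissible r Ω M)
      (SingleImpact.phi Ω M) := by
  constructor
  · rintro _ ⟨u, hu, rfl⟩
    exact SingleImpact.phi_le_resistance hr hopen hbdd hM hu
  · intro b hb
    refine le_of_forall_pos_le_add fun ε hε => ?_
    obtain ⟨u, hu, hle⟩ :=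
      SingleImpact.exists_admissible_resistance_le r hopen hconv hbdd hM hε
    exact (hb ⟨u, hu, rfl⟩).trans hle
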